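/- **Setting.** Let $\mathbf x^+=\mathbf f(\mathbf x,\mathbf w)$, $\mathbf y=\mathbf g(\mathbf x,\mathbf v)$ be a stochastic observed system with jointly measurable $\mathbf f:\mathbb R^n\times\Omega_{\mathbf w}\to\mathbb R^n$, $\mathbf g:\mathbb R^n\times\Omega_{\mathbf v}\to\mathbb R^p$ and noises $\mathbf w,\mathbf v$ of given laws. Let $\mathcal X\subset\mathbb R^n$, $\mathcal Y\subset\mathbb R^p$ be compact with $\mathbb P(\mathbf f(\mathbf x,\cdot)\in\mathcal X)=\mathbb P(\mathbf g(\mathbf x,\cdot)\in\mathcal Y)=1$ for all $\mathbf x\in\mathcal X$. Assume that for every $\mathbf x\in\mathcal X$ and $u\in\mathbb R^p$, $\mathbb E[((\mathbf g(\mathbf x,\cdot)-\mathbb E\,\mathbf g(\mathbf x,\cdot))^\top u)^2]=0$ implies $u=0$. Let $\mathcal H$ be a real reproducing kernel Hilbert space on $\mathcal X$ with continuous kernel $k$ and feature map $\Phi(x)=k(x,\cdot)$; let $\mu$ (sampling law) and $\mu_0$ (prior of the initial state) be Borel probability measures on $\mathcal X$. Write $(a\otimes b)c=\langle c,b\rangle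 a$ and identify $(\mathbb R^d)^*$ with $\mathbb R^d$. Define $$C_X=\mathbb E_{X\sim\mu}[\Phi(X)\otimes\Phi(X)],\quad C_{XX}=\mathbb E_{X\sim\mu}[\Phi(X)\otimes X],\quad \mathcal B=C_X^{-1}C_{XX}:\mathbb R^n\to\mathcal H,$$ $$(\mathcal U\psi)(x)=\mathbb E[\psi(\mathbf f(x,\cdot))],\qquad(\mathcal Gq)(x)=\mathbb E[\langle q,\mathbf g(x,\cdot)\rangle].$$ Assume that $\|C_X\psi\|\ge c_1\|\psi\|$ for all $\psi\in\mathcal H$, with some $c_1>0$, and that $\mathcal U\mathcal H\subseteq\mathcal H$, $\mathcal G\mathbb R^p\subseteq\mathcal H$, $\mathcal B\mathbb R^n\subseteq\mathcal H$ (that is, $C_{XX}q\in C_X\mathcal H$ for all $q\in\mathbb R^n$). Put $\|k\|_\infty=\sup_{x,x'}|k(x,x')|$ and $\mathbf g_\infty=\sup_{x\in\mathcal X}\big(\mathbb E\|\mathbf g(x,\cdot)\|^2+\|\mathbb E\,\mathbf g(x,\cdot)\|^2\big)$. **Infinite-dimensional filter.** Fix a horizon $T$, states $\mathbf x_0,\dots,\mathbf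 x_T\in\mathcal X$ and observations $\mathbf y_1,\dots,\mathbf y_T\in\mathbb R^p$. Let $\zeta_k=\Phi(\mathbf f(\mathbf x_k,\mathbf w))-\mathbb E\,\Phi(\mathbf f(\mathbf x_k,\cdot))$, $\nu_k=\mathbf g(\mathbf x_k,\mathbf v)-\mathbb E\,\mathbf g(\mathbf x_k,\cdot)$, $\mathcal Q_{k+1}=\mathrm{Cov}(\zeta_k)$, $\mathcal R_k=\mathrm{Cov}(\nu_k)$. Starting from $\hat\mu_0=\mathbb E_{\mu_0}\Phi$, $\mathcal P_0=\mathrm{Cov}_{\mu_0}(\Phi)$, define recursively $$\hat\mu_{k+1}^-=\mathcal U^*\hat\mu_k,\quad\mathcal P_{k+1}^-=\mathcal U^*\mathcal P_k\,\mathcal U+\mathcal Q_{k+1},\quad\mathcal S_{k+1}=\mathcal G^*\mathcal P_{k+1}^-\mathcal G+\mathcal R_{k+1},\quad\mathcal K_{k+1}=\mathcal P_{k+1}^-\mathcal G\,\mathcal S_{k+1}^{-1},$$ $$\hat\mu_{k+1}=\hat\mu_{k+1}^-+\mathcal K_{k+1}(\mathbf y_{k+1}-\mathcal G^*\hat\mu_{k+1}^-),\quad\mathcal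 P_{k+1}=(I-\mathcal K_{k+1}\mathcal G^*)\mathcal P_{k+1}^-,$$ and put $\hat{\mathbf x}_k=\mathcal B^*\hat\mu_k$, $\mathbf P_k=\mathcal B^*\mathcal P_k\mathcal B$. **Koopman Kalman filter (KKF).** For $N\ge2$ draw, all independently, $x_j\sim\mu$, noises $\mathbf w_j,\mathbf v_j$ giving $x_j^+=\mathbf f(x_j,\mathbf w_j)$ and $y_j=\mathbf g(x_j,\mathbf v_j)$, initial points $x_j^0\sim\mu_0$, and for every time samples of $\zeta_k$ and of $\nu_k$ ($1\le j\le N$). On $\mathcal H_N=\mathrm{span}\{\Phi(x_j)\}$ let $C_X^N=\frac1N\sum_j\Phi(x_j)\otimes\Phi(x_j)$, which is invertible on $\mathcal H_N$, and put $$\mathcal U_N=(C_X^N)^{-1}\tfrac1N\sum_j\Phi(x_j)\otimes\Phi(x_j^+),\quad\mathcal G_N=(C_X^N)^{-1}\tfrac1N\sum_j\Phi(x_j)\otimes y_j,\quad\mathcal B_N=(C_X^N)^{-1}\tfrac1N\sum_j\Phi(x_j)\otimes x_j,$$ regarded as operators $\mathcal H\to\mathcal H$, $\mathbb R^p\to\mathcal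 H$, $\mathbb R^n\to\mathcal H$. Let $\mathcal Q_{N,k+1}$, $\mathcal R_{N,k}$ be the sample covariances (normalised by $N-1$) of the samples of $\zeta_k$, $\nu_k$, and $\hat\mu_{N,0}$, $\mathcal P_{N,0}$ the sample mean and sample covariance of $\Phi(x_j^0)$. Then $(\hat\mu_{N,k},\mathcal P_{N,k})$ is given by the same recursion with $\mathcal U_N,\mathcal G_N,\mathcal Q_{N,k},\mathcal R_{N,k}$ and the same observations $\mathbf y_k$ (the gain being $0$ if $\mathcal S_{N,k}$ is not invertible), and $\hat{\mathbf x}_{N,k}=\mathcal B_N^*\hat\mu_{N,k}$, $\mathbf P_{N,k}=\mathcal B_N^*\mathcal P_{N,k}\mathcal B_N$. **Theorem (KKF error).** For every $\delta\in(0,1)$ there are constants $\tilde C^1_{k,\delta},\tilde C^2_{k,\delta}$ ($0\le k\le T$), not depending on $N$, such that for every $N\ge2$ with $$\delta>2\exp\Big(-\frac{Nc_1^2}{8\max\{\mathbf g_\infty,\|k\|_\infty\}}\Big),$$ with probability at least $(1-\delta)^{4+2(T+1)}$, for all $k\in\{0,\dots,T\}$, $$\|\hat{\mathbf x}_k-\hat{\mathbf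 x}_{N,k}\|\le\tilde C^1_{k,\delta}N^{-1/2},\qquad\|\mathbf P_k-\mathbf P_{N,k}\|\le\tilde C^2_{k,\delta}N^{-1/2}$$ (Euclidean norm and operator norm). -/

import Mathlib

open MeasureTheory InnerProductSpace

noncomputable section

namespace KKF

/-- The Euclidean space `ℝ^d`. -/
abbrev Euc (d : ℕ) : Type := EuclideanSpace ℝ (Fin d)

/-- A stochastic observed dynamical system `x⁺ = f(x, w)`, `y = g(x, v)` on `ℝ^n` with observations
in `ℝ^p`; `lawW` and `lawV` are the laws of the noises `w` and `v`. -/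
structure ObservedSystem (n p : ℕ) (Ωw Ωv : Type*) [MeasurableSpace Ωw] [MeasurableSpace Ωv] where
  f : Euc n → Ωw → Euc n
  g : Euc n → Ωv → Euc p
  lawW : Measure Ωw
  lawV : Measure Ωv
  isProbW : IsProbabilityMeasure lawW
  isProbV : IsProbabilityMeasure lawV
  measurable_f : Measurable (Function.uncurry f)
  measurable_g : Measurable (Function.uncurry g)

attribute [instance] ObservedSystem.isProbW ObservedSystem.isProbV

/-! ### Reproducing kernel Hilbert spaces over a set of states -/

section RKHS

variable {n : ℕ} {𝒳 : Set (Euc n)}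
  (H : Type*) [NormedAddCommGroup H] [InnerProductSpace ℝ H] [CompleteSpace H] [RKHS ℝ H 𝒳 ℝ]

/-- The scalar reproducing kernel `k(x, x')` of `H`. -/
def ker (x x' : 𝒳) : ℝ := RKHS.kernel H x x' 1

/-- The canonical feature map `Φ(x) = k(x, ·)`. -/
def feat (x : 𝒳) : H := RKHS.kerFun H x 1

/-- The feature map as a function on all of `ℝ^n`, extended by `0` outside `𝒳`. It is only ever
evaluated at random points that lie in `𝒳` almost surely. -/
def featExt : Euc n → H := Function.extend Subtype.val (feat H) 0

/-- `‖k‖_∞`. -/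
def kerSup : ℝ := ⨆ q : 𝒳 × 𝒳, |ker H q.1 q.2|

/-- The autocovariance operator `C_X = E[Φ(X) ⊗ Φ(X)]`, `X ∼ μ`. -/
def covX (μ : Measure 𝒳) : H →L[ℝ] H := ∫ x, rankOne ℝ (feat H x) (feat H x) ∂μ

/-- The operator `C_XX = E[Φ(X) ⊗ φ̃(X)] : ℝ^n → H`, with `φ̃` the identity of `𝒳`. -/
def covXId (μ : Measure 𝒳) : Euc n →L[ℝ] H := ∫ x, rankOne ℝ (feat H x) (x : Euc n) ∂μ

/-- The lifting-back operator `𝓑 = C_X⁻¹ C_XX` (with the inverse of an operator that is not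
invertible read as `0`). -/
def liftBack (μ : Measure 𝒳) : Euc n →L[ℝ] H := (covX H μ).inverse ∘L covXId H μ

/-- `𝓑 (ℝ^n)^* ⊆ H`: every `C_XX q` has a preimage under `C_X` in `H`. -/
def LiftBackInvariant (μ : Measure 𝒳) : Prop := ∀ q : Euc n, ∃ h : H, covX H μ h = covXId H μ q

/-- An operator `𝒯` from `D` to functions on `𝒳` maps `D` into `H`. -/
def MapsInto {D : Type*} (𝒯 : D → 𝒳 → ℝ) : Prop := ∀ d, ∃ h : H, ∀ x, h x = 𝒯 d x

open Classical in
/-- The bounded operator `D → H` induced by an operator `𝒯` from `D` to functions on `𝒳`. -/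
def toRKHS {D : Type*} [NormedAddCommGroup D] [NormedSpace ℝ D] (𝒯 : D → 𝒳 → ℝ) : D →L[ℝ] H :=
  if h : ∃ A : D →L[ℝ] H, ∀ d x, A d x = 𝒯 d x then h.choose else 0

end RKHS

/-! ### The system: invariant spaces, Koopman operators, noise covariances -/

/-- The covariance operator `E[(Z - E Z) ⊗ (Z - E Z)]` of a random element `Z`. -/
def covOp {Ω K : Type*} [MeasurableSpace Ω] [NormedAddCommGroup K] [InnerProductSpace ℝ K]
    (P : Measure Ω) (Z : Ω → K) : K →L[ℝ] K :=
  ∫ ω, rankOne ℝ (Z ω - ∫ ω', Z ω' ∂P) (Z ω - ∫ ω', Z ω' ∂P) ∂P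

namespace ObservedSystem

section

variable {n p : ℕ} {Ωw Ωv : Type*} [MeasurableSpace Ωw] [MeasurableSpace Ωv]
  (S : ObservedSystem n p Ωw Ωv)

/-- The transition measure `ρ_f(x, ·)`. -/
def rhoF (x : Euc n) : Measure (Euc n) := S.lawW.map (S.f x)

/-- The transition measure `ρ_g(x, ·)`. -/
def rhoG (x : Euc n) : Measure (Euc p) := S.lawV.map (S.g x)

/-- `(𝒳, 𝒴)` is a pair of invariant spaces. -/
def IsInvariantPair (𝒳 : Set (Euc n)) (𝒴 : Set (Euc p)) : Prop :=
  ∀ x ∈ 𝒳, S.rhoF x 𝒳 = 1 ∧ S.rhoG x 𝒴 = 1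

/-- The observation noise is nondegenerate at every state of `𝒳`: if the centred observation
`g(x, ·) - E[g(x, ·)]` has zero variance in the direction `u`, then `u = 0`. -/
def NondegenerateObs (𝒳 : Set (Euc n)) : Prop :=
  ∀ x ∈ 𝒳, ∀ u : Euc p,
    ∫ v, (inner ℝ (S.g x v - ∫ v', S.g x v' ∂S.lawV) u) ^ 2 ∂S.lawV = 0 → u = 0

/-- `g_∞ = sup_{x ∈ 𝒳} (E[g(x,·)²] + E[g(x,·)]²)`, squares being squared Euclidean norms. -/
def gSup (𝒳 : Set (Euc n)) : ℝ :=
  ⨆ x : 𝒳, ((∫ v, ‖S.g x v‖ ^ 2 ∂S.lawV) + ‖∫ v, S.g x v ∂S.lawV‖ ^ 2)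

/-- The Koopman operator on functions: `(𝓤 ψ)(x) = E[ψ(f(x, ·))]`. -/
def koopmanFun {𝒳 : Set (Euc n)} (ψ : 𝒳 → ℝ) (x : 𝒳) : ℝ :=
  ∫ w, Function.extend Subtype.val ψ 0 (S.f x w) ∂S.lawW

/-- The observation Koopman operator on the linear functionals `⟨q, ·⟩` of `ℝ^p`:
`(𝓖 q)(x) = E[⟨q, g(x, ·)⟩]`. -/
def obsFun {𝒳 : Set (Euc n)} (q : Euc p) (x : 𝒳) : ℝ := ∫ v, inner ℝ q (S.g x v) ∂S.lawV

variable {𝒳 : Set (Euc n)}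
  (H : Type*) [NormedAddCommGroup H] [InnerProductSpace ℝ H] [CompleteSpace H] [RKHS ℝ H 𝒳 ℝ]

/-- `𝓤 H ⊆ H`. -/
def KoopmanInvariant : Prop := MapsInto H (fun ψ : H => S.koopmanFun (ψ : 𝒳 → ℝ))

/-- `𝓖 (ℝ^p)^* ⊆ H`. -/
def ObsInvariant : Prop := MapsInto H (fun q : Euc p => S.obsFun (𝒳 := 𝒳) q)

/-- The Koopman operator `𝓤 : H → H`. -/
def koopman : H →L[ℝ] H := toRKHS H (fun ψ : H => S.koopmanFun (ψ : 𝒳 → ℝ))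

/-- The observation Koopman operator `𝓖 : (ℝ^p)^* ≅ ℝ^p → H`. -/
def obs : Euc p →L[ℝ] H := toRKHS H (fun q : Euc p => S.obsFun (𝒳 := 𝒳) q)

/-- The embedded dynamics noise at state `x`: `ζ = Φ(f(x, w)) - E[Φ(f(x, ·))]`. -/
def zeta (x : 𝒳) (w : Ωw) : H :=
  featExt H (S.f x w) - ∫ w', featExt H (S.f x w') ∂S.lawW

/-- The observation noise at state `x`: `ν = g(x, v) - E[g(x, ·)]`. -/
def nu (x : 𝒳) (v : Ωv) : Euc p := S.g x v - ∫ v', S.g x v' ∂S.lawV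

end

end ObservedSystem

/-! ### The Kalman recursion -/

section Kalman

variable {H F : Type*} [NormedAddCommGroup H] [InnerProductSpace ℝ H] [CompleteSpace H]
  [NormedAddCommGroup F] [InnerProductSpace ℝ F] [CompleteSpace F]

/-- One step `(μ̂, 𝒫) ↦ (μ̂', 𝒫')` of the Kalman rule with state operator `A`, observation operator
`C`, noise covariances `Q`, `R` and new observation `y`:
`μ⁻ = A μ̂`, `𝒫⁻ = A 𝒫 A* + Q`, `𝒮 = C 𝒫⁻ C* + R`, `𝒦 = 𝒫⁻ C* 𝒮⁻¹`,
`μ̂' = μ⁻ + 𝒦 (y - C μ⁻)`, `𝒫' = (I - 𝒦 C) 𝒫⁻`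
(with `𝒮⁻¹` read as `0` if `𝒮` is not invertible). -/
def kalmanStep (A : H →L[ℝ] H) (C : H →L[ℝ] F) (Q : H →L[ℝ] H) (R : F →L[ℝ] F) (y : F)
    (s : H × (H →L[ℝ] H)) : H × (H →L[ℝ] H) :=
  let m : H := A s.1
  let P : H →L[ℝ] H := A ∘L s.2 ∘L A.adjoint + Q
  let Sinn : F →L[ℝ] F := C ∘L P ∘L C.adjoint + R
  let K : F →L[ℝ] H := P ∘L C.adjoint ∘L Sinn.inverse
  (m + K (y - C m), (ContinuousLinearMap.id ℝ H - K ∘L C) ∘L P)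

/-- The Kalman recursion: the step from time `k` to time `k + 1` uses `Q (k + 1)`, `R (k + 1)` and
the observation `y (k + 1)`. -/
def kalman (A : H →L[ℝ] H) (C : H →L[ℝ] F) (Q : ℕ → H →L[ℝ] H) (R : ℕ → F →L[ℝ] F) (y : ℕ → F)
    (s₀ : H × (H →L[ℝ] H)) : ℕ → H × (H →L[ℝ] H)
  | 0 => s₀
  | k + 1 => kalmanStep A C (Q (k + 1)) (R (k + 1)) (y (k + 1)) (kalman A C Q R y s₀ k)

end Kalman

/-! ### The infinite-dimensional filter -/

namespace ObservedSystem

section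

variable {n p : ℕ} {Ωw Ωv : Type*} [MeasurableSpace Ωw] [MeasurableSpace Ωv]
  (S : ObservedSystem n p Ωw Ωv) {𝒳 : Set (Euc n)}
  (H : Type*) [NormedAddCommGroup H] [InnerProductSpace ℝ H] [CompleteSpace H] [RKHS ℝ H 𝒳 ℝ]

/-- The pair `(μ̂_k, 𝒫_k)` of the infinite-dimensional filter along the states `x` and the
observations `y`, with prior `μ₀` on the initial state. The state noise entering at time `k ≥ 1` is
that of the transition from `x (k - 1)`, the observation noise is that at `x k`. -/
def filter (μ₀ : Measure 𝒳) (x : ℕ → 𝒳) (y : ℕ → Euc p) : ℕ → H × (H →L[ℝ] H) :=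
  kalman (S.koopman H).adjoint (S.obs H).adjoint
    (fun k => covOp S.lawW (S.zeta H (x (k - 1)))) (fun k => covOp S.lawV (S.nu (x k))) y
    (∫ z, feat H z ∂μ₀, covOp μ₀ (feat H))

/-- The state estimate `x̂_k = 𝓑* μ̂_k`. -/
def stateEst (μ μ₀ : Measure 𝒳) (x : ℕ → 𝒳) (y : ℕ → Euc p) (k : ℕ) : Euc n :=
  (liftBack H μ).adjoint (S.filter H μ₀ x y k).1

/-- The covariance matrix `P_k = 𝓑* 𝒫_k 𝓑`, as an operator on `ℝ^n`. -/
def stateCov (μ μ₀ : Measure 𝒳) (x : ℕ → 𝒳) (y : ℕ → Euc p) (k : ℕ) : Euc n →L[ℝ] Euc n :=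
  (liftBack H μ).adjoint ∘L (S.filter H μ₀ x y k).2 ∘L liftBack H μ

end

end ObservedSystem

/-! ### Empirical operators -/

section Empirical

variable {n N : ℕ} {𝒳 : Set (Euc n)}
  (H : Type*) [NormedAddCommGroup H] [InnerProductSpace ℝ H] [CompleteSpace H] [RKHS ℝ H 𝒳 ℝ]
  {K : Type*} [NormedAddCommGroup K] [InnerProductSpace ℝ K]

/-- The subspace `H_N = span {Φ(x_i)}`. -/
def empSpan (ξ : Fin N → 𝒳) : Submodule ℝ H := Submodule.span ℝ (Set.range fun i => feat H (ξ i))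

/-- The empirical operator `(1/N) ∑_j Φ(x_j) ⊗ z_j`. -/
def empCov (ξ : Fin N → 𝒳) (z : Fin N → K) : K →L[ℝ] H :=
  (1 / (N : ℝ)) • ∑ j, rankOne ℝ (feat H (ξ j)) (z j)

theorem empCov_mem (ξ : Fin N → 𝒳) (z : Fin N → K) (v : K) :
    empCov H ξ z v ∈ empSpan H ξ := by
  simp only [empCov, smul_apply, sum_apply, rankOne_apply]
  refine Submodule.smul_mem _ _ (Submodule.sum_mem _ fun j _ => Submodule.smul_mem _ _ ?_)
  exact Submodule.subset_span ⟨j, rfl⟩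

/-- The empirical autocovariance `C_X^N = (1/N) ∑_j Φ(x_j) ⊗ Φ(x_j)` as an operator on `H_N`. -/
def empCovX (ξ : Fin N → 𝒳) : empSpan H ξ →L[ℝ] empSpan H ξ :=
  ((empCov H ξ fun j => feat H (ξ j)).codRestrict (empSpan H ξ)
    fun v => empCov_mem H ξ (fun j => feat H (ξ j)) v) ∘L (empSpan H ξ).subtypeL

/-- The operator `(C_X^N)⁻¹ ((1/N) ∑_j Φ(x_j) ⊗ z_j)`, where `C_X^N` is inverted on `H_N`. -/
def empRegress (ξ : Fin N → 𝒳) (z : Fin N → K) : K →L[ℝ] H :=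
  (empSpan H ξ).subtypeL ∘L (empCovX H ξ).inverse ∘L
    (empCov H ξ z).codRestrict (empSpan H ξ) fun v => empCov_mem H ξ z v

/-- The sample mean. -/
def sampleMean (z : Fin N → K) : K := (1 / (N : ℝ)) • ∑ j, z j

/-- The unbiased sample covariance `(1/(N-1)) ∑_j (z_j - z̄) ⊗ (z_j - z̄)`. -/
def sampleCov (z : Fin N → K) : K →L[ℝ] K :=
  (1 / ((N : ℝ) - 1)) • ∑ j, rankOne ℝ (z j - sampleMean z) (z j - sampleMean z)

end Empirical

/-- The random draws that the approximate filter uses. All of them are independent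
(see `ObservedSystem.sampleLaw`). -/
structure Samples (n : ℕ) (𝒳 : Set (Euc n)) (Ωw Ωv : Type*) (N : ℕ) where
  /-- the points `x_j ∼ μ` -/
  pt : Fin N → 𝒳
  /-- the state noises that generate `x_j⁺ = f(x_j, w_j)` -/
  w : Fin N → Ωw
  /-- the observation noises that generate `y_j = g(x_j, v_j)` -/
  v : Fin N → Ωv
  /-- the draws from the prior of the initial state -/
  init : Fin N → 𝒳
  /-- the state noises that generate the samples of the noise entering at time `k` -/
  wk : ℕ → Fin N → Ωw
  /-- the observation noises that generate the samples of the noise at time `k` -/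
  vk : ℕ → Fin N → Ωv

/-- The draws as a tuple. -/
abbrev SampleTuple (n : ℕ) (𝒳 : Set (Euc n)) (Ωw Ωv : Type*) (N : ℕ) :=
  (Fin N → 𝒳) × (Fin N → Ωw) × (Fin N → Ωv) × (Fin N → 𝒳) × (ℕ → Fin N → Ωw) × (ℕ → Fin N → Ωv)

/-- Names for the components of a tuple of draws. -/
def SampleTuple.unpack {n : ℕ} {𝒳 : Set (Euc n)} {Ωw Ωv : Type*} {N : ℕ}
    (s : SampleTuple n 𝒳 Ωw Ωv N) : Samples n 𝒳 Ωw Ωv N :=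
  ⟨s.1, s.2.1, s.2.2.1, s.2.2.2.1, s.2.2.2.2.1, s.2.2.2.2.2⟩

namespace ObservedSystem

section

variable {n p N : ℕ} {Ωw Ωv : Type*} [MeasurableSpace Ωw] [MeasurableSpace Ωv]
  (S : ObservedSystem n p Ωw Ωv) {𝒳 : Set (Euc n)}

/-- The joint law of the draws: the product of the laws of all components. -/
def sampleLaw (μ μ₀ : Measure 𝒳) [IsProbabilityMeasure μ] [IsProbabilityMeasure μ₀] (N : ℕ) :
    Measure (SampleTuple n 𝒳 Ωw Ωv N) :=
  (Measure.pi fun _ : Fin N => μ).prod <|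
  (Measure.pi fun _ : Fin N => S.lawW).prod <|
  (Measure.pi fun _ : Fin N => S.lawV).prod <|
  (Measure.pi fun _ : Fin N => μ₀).prod <|
  (Measure.infinitePi fun _ : ℕ => Measure.pi fun _ : Fin N => S.lawW).prod
  (Measure.infinitePi fun _ : ℕ => Measure.pi fun _ : Fin N => S.lawV)

variable (H : Type*) [NormedAddCommGroup H] [InnerProductSpace ℝ H] [CompleteSpace H]
  [RKHS ℝ H 𝒳 ℝ]

/-- `𝓤_N = (C_X^N)⁻¹ C_{XX⁺}^N`. -/
def koopmanN (s : Samples n 𝒳 Ωw Ωv N) : H →L[ℝ] H :=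
  empRegress H s.pt fun j => featExt H (S.f (s.pt j) (s.w j))

/-- `𝓖_N = (C_X^N)⁻¹ C_{XY}^N`. -/
def obsN (s : Samples n 𝒳 Ωw Ωv N) : Euc p →L[ℝ] H :=
  empRegress H s.pt fun j => S.g (s.pt j) (s.v j)

/-- `𝓑_N = (C_X^N)⁻¹ C_{XX}^N`. -/
def liftBackN (s : Samples n 𝒳 Ωw Ωv N) : Euc n →L[ℝ] H :=
  empRegress H s.pt fun j => (s.pt j : Euc n)

/-- The pair `(μ̂_{N,k}, 𝒫_{N,k})` of the Koopman Kalman filter. -/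
def filterN (x : ℕ → 𝒳) (y : ℕ → Euc p) (s : Samples n 𝒳 Ωw Ωv N) : ℕ → H × (H →L[ℝ] H) :=
  kalman (S.koopmanN H s).adjoint (S.obsN H s).adjoint
    (fun k => sampleCov fun j => S.zeta H (x (k - 1)) (s.wk k j))
    (fun k => sampleCov fun j => S.nu (x k) (s.vk k j)) y
    (sampleMean fun j => feat H (s.init j), sampleCov fun j => feat H (s.init j))

/-- The KKF state estimate `x̂_{N,k} = 𝓑_N* μ̂_{N,k}`. -/
def stateEstN (x : ℕ → 𝒳) (y : ℕ → Euc p) (s : Samples n 𝒳 Ωw Ωv N) (k : ℕ) : Euc n :=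
  (liftBackN H s).adjoint (S.filterN H x y s k).1

/-- The KKF covariance matrix `P_{N,k} = 𝓑_N* 𝒫_{N,k} 𝓑_N`, as an operator on `ℝ^n`. -/
def stateCovN (x : ℕ → 𝒳) (y : ℕ → Euc p) (s : Samples n 𝒳 Ωw Ωv N) (k : ℕ) :
    Euc n →L[ℝ] Euc n :=
  (liftBackN H s).adjoint ∘L (S.filterN H x y s k).2 ∘L liftBackN H s

end

end ObservedSystem

end KKF

end

noncomputable section

namespace KKF

open Filter Topology ProbabilityTheory
open scoped ENNReal

/-! The constants may depend on `δ` but not on `N`, and the required probability is a fixed number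
below `1`. Hence it suffices that the errors are `O_P(N^(-1/2))` (`RootNClose`): this gives one
constant for all large `N`, and each of the finitely many remaining `N` has its own constant because
the error is finite (`RootNClose.exists_forall_le_measure`).

The problem is finite-dimensional. `C_X` is an integral of rank-one operators, hence compact; being
bounded below as well, it forces `dim H < ∞` (`finiteDimensional_of_covX`). Chebyshev's inequality
in coordinates then makes all sample means and sample covariances `√N`-consistent
(`rootNClose_mean`, `rootNClose_sampleCov`).

The operators `𝓤`, `𝓖`, `𝓑` solve normal equations `C_X A = E[Φ(X) ⊗ Z]`, and their empirical
versions solve the empirical ones. Coercivity of `C_X` bounds the difference of the solutions by the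
difference of the data (`norm_empRegress_sub_le`).

Finally, the Kalman step is differentiable in all its inputs wherever the innovation operator is
invertible. Along the exact filter it is: the covariances stay positive (`isPositive_posterior`) and
the observation noise is nondegenerate (`isInvertible_innovation`). The delta method
(`RootNClose.map`) carries consistency through the recursion and the lifting back. The empirical
innovation needs no separate study, since only the behaviour near the limit counts. -/

/-! ### Convergence in probability at the rate `N^(-1/2)` -/

/-- The rate `N^(-1/2)`. -/
def rate (N : ℕ) : ℝ := (N : ℝ) ^ (-(1 / 2) : ℝ)

theorem rate_nonneg (N : ℕ) : 0 ≤ rate N := by unfold rate; positivity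

theorem rate_pos {N : ℕ} (hN : 0 < N) : 0 < rate N := by unfold rate; positivity

theorem rate_sq (N : ℕ) : rate N ^ 2 = (N : ℝ)⁻¹ := by
  rw [rate, ← Real.rpow_natCast, ← Real.rpow_mul (by positivity)]
  norm_num [Real.rpow_neg_one]

theorem tendsto_rate : Tendsto rate atTop (𝓝 0) :=
  (tendsto_rpow_neg_atTop (by norm_num : (0 : ℝ) < 1 / 2)).comp tendsto_natCast_atTop_atTop

section RootNClose

variable {Ω Ω' : ℕ → Type*} [∀ N, MeasurableSpace (Ω N)] [∀ N, MeasurableSpace (Ω' N)]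
  {E F G : Type*} [NormedAddCommGroup E] [NormedAddCommGroup F] [NormedAddCommGroup G]

/-- `Z N - a = O_P(N^(-1/2))`: the random elements `Z N` are `√N`-consistent for `a`. -/
def RootNClose (P : ∀ N, Measure (Ω N)) (Z : ∀ N, Ω N → E) (a : E) : Prop :=
  ∀ η : ℝ≥0∞, 0 < η → ∃ L : ℝ, ∀ᶠ N in atTop, P N {s | L * rate N < ‖Z N s - a‖} ≤ η

variable {P : ∀ N, Measure (Ω N)}

theorem RootNClose.of_deterministic {z : ℕ → E} {a : E} {C : ℝ}
    (h : ∀ᶠ N in atTop, ‖z N - a‖ ≤ C * rate N) : RootNClose P (fun N _ => z N) a := by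
  refine fun η _ => ⟨C, h.mono fun N hN => ?_⟩
  have : {s : Ω N | C * rate N < ‖z N - a‖} = ∅ := by
    ext; simpa using hN
  simp [this]

/-- A consistent estimator controls every quantity that is Lipschitz at the limit. -/
theorem RootNClose.of_calm {Z : ∀ N, Ω N → E} {a : E} {W : ∀ N, Ω N → F} {b : F}
    (hZ : RootNClose P Z a) {r C : ℝ} (hr : 0 < r) (hC : 0 ≤ C)
    (h : ∀ᶠ N in atTop, ∀ s, ‖Z N s - a‖ ≤ r → ‖W N s - b‖ ≤ C * ‖Z N s - a‖) :
    RootNClose P W b := by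
  intro η hη
  obtain ⟨L, hL⟩ := hZ η hη
  refine ⟨C * L, ?_⟩
  have hsmall : ∀ᶠ N in atTop, L * rate N < r :=
    (by simpa using tendsto_rate.const_mul L : Tendsto (fun N => L * rate N) atTop (𝓝 0))
      |>.eventually_lt_const hr
  filter_upwards [hL, h, hsmall] with N hN hN' hNr
  refine (measure_mono fun s hs => ?_).trans hN
  simp only [Set.mem_ofPred_eq] at hs ⊢
  by_contra! hlt
  have := hN' s (hlt.trans hNr.le)
  have := mul_le_mul_of_nonneg_left hlt hC
  nlinarith

/-- A union bound, so no independence of the two estimators is needed. -/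
theorem RootNClose.prodMk {Z : ∀ N, Ω N → E} {a : E} {W : ∀ N, Ω N → F} {b : F}
    (hZ : RootNClose P Z a) (hW : RootNClose P W b) :
    RootNClose P (fun N s => (Z N s, W N s)) (a, b) := by
  intro η hη
  obtain ⟨L, hL⟩ := hZ (η / 2) (ENNReal.half_pos hη.ne')
  obtain ⟨M, hM⟩ := hW (η / 2) (ENNReal.half_pos hη.ne')
  refine ⟨max L M, ?_⟩
  filter_upwards [hL, hM] with N hN hN'
  refine (measure_mono (t := {s | L * rate N < ‖Z N s - a‖} ∪ {s | M * rate N < ‖W N s - b‖})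
    fun s hs => ?_).trans
    ((measure_union_le _ _).trans ((add_le_add hN hN').trans (ENNReal.add_halves η).le))
  simp only [Set.mem_ofPred_eq, Prod.mk_sub_mk, Prod.norm_mk, lt_sup_iff] at hs
  rcases hs with hs | hs
  · exact .inl ((mul_le_mul_of_nonneg_right (le_max_left L M) (rate_nonneg N)).trans_lt hs)
  · exact .inr ((mul_le_mul_of_nonneg_right (le_max_right L M) (rate_nonneg N)).trans_lt hs)

theorem RootNClose.pi {ι : Type*} [Fintype ι] {Z : ι → ∀ N, Ω N → E} {a : ι → E}
    (hZ : ∀ i, RootNClose P (Z i) (a i)) :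
    RootNClose P (fun N s i => Z i N s) a := by
  intro η hη
  have hη' : 0 < η / (Fintype.card ι + 1) := ENNReal.div_pos hη.ne' (by finiteness)
  choose L hL using fun i => hZ i _ hη'
  refine ⟨∑ i, |L i|, ?_⟩
  filter_upwards [eventually_all.2 hL] with N hN
  have hsub : {s | (∑ i, |L i|) * rate N < ‖(fun i => Z i N s) - a‖} ⊆
      ⋃ i, {s | L i * rate N < ‖Z i N s - a i‖} := by
    intro s hs
    by_contra hcon
    simp only [Set.mem_iUnion, Set.mem_ofPred_eq, not_exists, not_lt] at hcon hs
    refine hs.not_ge ((pi_norm_le_iff_of_nonneg ?_).2 fun i => (hcon i).trans ?_)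
    · exact mul_nonneg (Finset.sum_nonneg fun _ _ => abs_nonneg _) (rate_nonneg N)
    · refine mul_le_mul_of_nonneg_right ((le_abs_self _).trans ?_) (rate_nonneg N)
      exact Finset.single_le_sum (f := fun i => |L i|) (fun _ _ => abs_nonneg _)
        (Finset.mem_univ i)
  calc P N _ ≤ ∑ i, P N {s | L i * rate N < ‖Z i N s - a i‖} :=
        (measure_mono hsub).trans (measure_iUnion_fintype_le _ _)
    _ ≤ ∑ _i : ι, η / (Fintype.card ι + 1) := Finset.sum_le_sum fun i _ => hN i
    _ = Fintype.card ι * (η / (Fintype.card ι + 1)) := by simp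
    _ ≤ (Fintype.card ι + 1) * (η / (Fintype.card ι + 1)) := by gcongr; exact le_self_add
    _ ≤ η := ENNReal.mul_div_le

/-- The delta method. -/
theorem RootNClose.map [NormedSpace ℝ E] [NormedSpace ℝ F]
    {Z : ∀ N, Ω N → E} {a : E} (hZ : RootNClose P Z a) {φ : E → F}
    (hφ : DifferentiableAt ℝ φ a) : RootNClose P (fun N s => φ (Z N s)) (φ a) := by
  -- Of differentiability only `‖φ z - φ a‖ ≤ C ‖z - a‖` for `z` near `a` is needed.
  obtain ⟨C, hC, h⟩ := hφ.isBigO_sub.exists_nonneg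
  obtain ⟨r, hr, h⟩ := Metric.eventually_nhds_iff.1 h.bound
  refine hZ.of_calm (half_pos hr) hC (.of_forall fun N s hs => h ?_)
  rw [dist_eq_norm]
  linarith

/-- Consistency depends only on the law of the draws that enter the estimator. The bound of the
measure of a preimage by the image measure holds for arbitrary sets, so `Z` need not be measurable.
-/
theorem RootNClose.comp_measurePreserving {P' : ∀ N, Measure (Ω' N)} {Z : ∀ N, Ω' N → E} {a : E}
    (hZ : RootNClose P' Z a) {φ : ∀ N, Ω N → Ω' N} (hφ : ∀ N, MeasurePreserving (φ N) (P N) (P' N)) :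
    RootNClose P (fun N s => Z N (φ N s)) a := by
  intro η hη
  obtain ⟨L, hL⟩ := hZ η hη
  refine ⟨L, hL.mono fun N hN => le_trans ?_ hN⟩
  have := Measure.le_map_apply (μ := P N) (hφ N).measurable.aemeasurable
    {s | L * rate N < ‖Z N s - a‖}
  rwa [(hφ N).map_eq] at this

/-- A single constant bounds the error of a consistent estimator at all sample sizes, with
probability as close to `1` as desired. -/
theorem RootNClose.exists_forall_le_measure [∀ N, IsProbabilityMeasure (P N)]
    {Z : ∀ N, Ω N → E} {a : E} (hZ : RootNClose P Z a) {q : ℝ≥0∞} (hq : q < 1) :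
    ∃ C : ℝ, ∀ N, 0 < N → q ≤ P N {s | ‖Z N s - a‖ ≤ C * rate N} := by
  obtain ⟨L, hL⟩ := hZ (1 - q) (tsub_pos_of_lt hq)
  obtain ⟨N₀, hN₀⟩ := eventually_atTop.1 hL
  -- At a fixed `N` the sets where the error is at most `m * rate N` increase to the whole space;
  -- continuity from below, valid without measurability, gives a constant for this `N`.
  have hsmall : ∀ N, ∃ c : ℝ, 0 < N → q ≤ P N {s | ‖Z N s - a‖ ≤ c * rate N} := by
    intro N
    rcases Nat.eq_zero_or_pos N with rfl | hN
    · exact ⟨0, by simp⟩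
    have hmono : Monotone fun m : ℕ => {s | ‖Z N s - a‖ ≤ m * rate N} := by
      intro m m' hm s hs
      refine le_trans (b := m * rate N) hs ?_
      have := rate_nonneg N
      gcongr
    have hunion : ⋃ m : ℕ, {s | ‖Z N s - a‖ ≤ m * rate N} = Set.univ := by
      refine Set.eq_univ_of_forall fun s => Set.mem_iUnion.2 ?_
      obtain ⟨m, hm⟩ := exists_nat_ge (‖Z N s - a‖ / rate N)
      exact ⟨m, (div_le_iff₀ (rate_pos hN)).1 hm⟩
    have := tendsto_measure_iUnion_atTop (μ := P N) hmono
    rw [hunion, measure_univ] at this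
    obtain ⟨m, hm⟩ := (this.eventually_const_lt hq).exists
    exact ⟨m, fun _ => hm.le⟩
  choose c hc using hsmall
  refine ⟨max L (∑ N ∈ Finset.range N₀, |c N|), fun N hN => ?_⟩
  rcases lt_or_ge N N₀ with h | h
  · refine (hc N hN).trans (measure_mono fun s hs => le_trans (b := c N * rate N) hs ?_)
    refine mul_le_mul_of_nonneg_right (le_max_of_le_right ((le_abs_self _).trans ?_))
      (rate_nonneg N)
    exact Finset.single_le_sum (f := fun i => |c i|) (fun _ _ => abs_nonneg _)
      (Finset.mem_range.2 h)
  -- Subadditivity replaces passing to the complement, as the error is not assumed measurable.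
  · have huniv : 1 ≤ P N {s | ‖Z N s - a‖ ≤ L * rate N} +
        P N {s | L * rate N < ‖Z N s - a‖} := by
      rw [← measure_univ (μ := P N)]
      refine (measure_mono fun s _ => ?_).trans (measure_union_le _ _)
      exact le_or_gt ‖Z N s - a‖ (L * rate N)
    have h1 : q ≤ P N {s | ‖Z N s - a‖ ≤ L * rate N} := by
      have h2 := huniv.trans (add_le_add_right (hN₀ N h) _)
      have h3 : q + (1 - q) = 1 := add_tsub_cancel_of_le hq.le
      exact (ENNReal.add_le_add_iff_right (by finiteness)).1 (h3.le.trans h2)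
    refine h1.trans (measure_mono fun s hs => le_trans (b := L * rate N) hs ?_)
    exact mul_le_mul_of_nonneg_right (le_max_left _ _) (rate_nonneg N)

end RootNClose

/-! ### Sample means of independent draws -/

section SampleMean

variable {Ω V : Type*} [MeasurableSpace Ω] {P : Measure Ω} [IsProbabilityMeasure P]
  [NormedAddCommGroup V] [NormedSpace ℝ V]

/-- Chebyshev's inequality: the variances of the independent coordinates add up to `N * variance X
P`. -/
theorem measure_sum_sub_ge_le {X : Ω → ℝ} (hX : MemLp X 2 P) {N : ℕ} {c : ℝ} (hc : 0 < c) :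
    (Measure.pi fun _ : Fin N => P) {ω | c ≤ |∑ j, X (ω j) - N * ∫ ω, X ω ∂P|} ≤
      ENNReal.ofReal (N * variance X P / c ^ 2) := by
  set Q := Measure.pi fun _ : Fin N => P
  have hmp : ∀ j : Fin N, MeasurePreserving (Function.eval j) Q P := measurePreserving_eval _
  have hmem : ∀ j : Fin N, MemLp (fun ω : Fin N → Ω => X (ω j)) 2 Q := fun j =>
    hX.comp_measurePreserving (hmp j)
  have hindep : iIndepFun (fun (j : Fin N) (ω : Fin N → Ω) => X (ω j)) Q :=
    iIndepFun_pi fun _ => hX.1.aemeasurable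
  have hvar : variance (∑ j, fun ω : Fin N → Ω => X (ω j)) Q = N * variance X P := by
    rw [IndepFun.variance_sum (fun j _ => hmem j) fun i _ j _ hij => hindep.indepFun hij]
    have : ∀ j : Fin N, variance (fun ω : Fin N → Ω => X (ω j)) Q = variance X P := fun j => by
      have h1 := (hmp j).map_eq
      have := variance_map (X := X) (Y := Function.eval j) (μ := Q)
        (by rw [h1]; exact hX.1.aemeasurable) (hmp j).measurable.aemeasurable
      rw [h1] at this
      exact this.symm
    simp [this]
  have hint : ∫ ω, (∑ j, fun ω : Fin N → Ω => X (ω j)) ω ∂Q = N * ∫ ω, X ω ∂P := by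
    simp only [Finset.sum_apply]
    rw [integral_finsetSum _ fun j _ => (hmem j).integrable (by norm_num)]
    have : ∀ j : Fin N, ∫ ω, X (ω j) ∂Q = ∫ ω, X ω ∂P := fun j => by
      have h1 := (hmp j).map_eq
      have := integral_map (μ := Q) (φ := Function.eval j) (hmp j).measurable.aemeasurable
        (f := X) (by rw [h1]; exact hX.1)
      rw [h1] at this
      exact this.symm
    simp [this]
  have := meas_ge_le_variance_div_sq (memLp_finsetSum' _ fun j _ => hmem j) hc (μ := Q)
    (X := ∑ j, fun ω : Fin N → Ω => X (ω j))
  rw [hvar, hint] at this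
  simpa using this

/-- Since `rate N ^ 2 = 1 / N`, Chebyshev's inequality for the sum at deviation `N * (L * rate N)`
gives the bound `variance X P / L ^ 2`, which is free of `N` and small for large `L`. -/
theorem rootNClose_mean_real {X : Ω → ℝ} (hX : MemLp X 2 P) :
    RootNClose (fun N => Measure.pi fun _ : Fin N => P)
      (fun N ω => (1 / (N : ℝ)) • ∑ j, X (ω j)) (∫ ω, X ω ∂P) := by
  intro η hη
  obtain ⟨L, hL, hLη⟩ : ∃ L : ℝ, 0 < L ∧ ENNReal.ofReal (variance X P / L ^ 2) ≤ η := by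
    have : Tendsto (fun L : ℝ => ENNReal.ofReal (variance X P / L ^ 2)) atTop (𝓝 0) := by
      rw [← ENNReal.ofReal_zero]
      refine ENNReal.tendsto_ofReal (Tendsto.div_atTop tendsto_const_nhds ?_)
      exact tendsto_pow_atTop two_ne_zero
    obtain ⟨L, h1, h2⟩ := ((this.eventually_lt_const hη).and (eventually_gt_atTop 0)).exists
    exact ⟨L, h2, h1.le⟩
  refine ⟨L, (eventually_gt_atTop 0).mono fun N hN => ?_⟩
  have hN' : (0 : ℝ) < N := by exact_mod_cast hN
  have hr := rate_pos hN
  refine le_trans (measure_mono fun ω hω => ?_) ((measure_sum_sub_ge_le hX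
    (show 0 < N * (L * rate N) by positivity)).trans (le_trans (le_of_eq ?_) hLη))
  · simp only [Set.mem_ofPred_eq] at hω ⊢
    have : ∑ j, X (ω j) - N * ∫ ω, X ω ∂P = N * ((1 / (N : ℝ)) • ∑ j, X (ω j) - ∫ ω, X ω ∂P) := by
      rw [smul_eq_mul]; field_simp
    rw [this, abs_mul, abs_of_pos hN']
    exact (mul_lt_mul_of_pos_left hω hN').le
  · congr 1
    rw [mul_pow, mul_pow, rate_sq]
    field_simp

/-- The sample mean of bounded random elements of a finite-dimensional space is `√N`-consistent. -/
theorem rootNClose_mean [FiniteDimensional ℝ V] {Z : Ω → V} (hZ : AEStronglyMeasurable Z P) {M : ℝ}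
    (hM : ∀ᵐ ω ∂P, ‖Z ω‖ ≤ M) :
    RootNClose (fun N => Measure.pi fun _ : Fin N => P)
      (fun N ω => (1 / (N : ℝ)) • ∑ j, Z (ω j)) (∫ ω, Z ω ∂P) := by
  have : CompleteSpace V := FiniteDimensional.complete ℝ V
  let b := Module.finBasis ℝ V
  obtain ⟨φ, hφ⟩ : ∃ φ : Fin (Module.finrank ℝ V) → V →L[ℝ] ℝ, ∀ v, ∑ i, φ i v • b i = v :=
    ⟨fun i => (b.coord i).toContinuousLinearMap, fun v => b.sum_repr v⟩
  have hint : Integrable Z P := .of_bound hZ M hM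
  have hcoord : ∀ i, RootNClose (fun N => Measure.pi fun _ : Fin N => P)
      (fun N ω => (1 / (N : ℝ)) • ∑ j, φ i (Z (ω j))) (φ i (∫ ω, Z ω ∂P)) := by
    intro i
    rw [← (φ i).integral_comp_comm hint]
    have hmem : MemLp (fun ω => φ i (Z ω)) 2 P :=
      .of_bound ((φ i).continuous.comp_aestronglyMeasurable hZ) (‖φ i‖ * M)
        (hM.mono fun ω hω => ((φ i).le_opNorm _).trans (by gcongr))
    have h := rootNClose_mean_real hmem
    exact h
  let ψ : (Fin (Module.finrank ℝ V) → ℝ) → V := fun u => ∑ i, u i • b i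
  have hψ : Differentiable ℝ ψ := by unfold ψ; fun_prop
  -- The vector is reassembled from its coordinates by the linear map `ψ`.
  have hmap := (RootNClose.pi hcoord).map (φ := ψ) (hψ _)
  have key : ∀ v : V, ψ (fun i => φ i v) = v := hφ
  have key' : ∀ (N : ℕ) (ω : Fin N → Ω), ψ (fun i => (1 / (N : ℝ)) • ∑ j, φ i (Z (ω j))) =
      (1 / (N : ℝ)) • ∑ j, Z (ω j) := fun N ω => by
    rw [← key ((1 / (N : ℝ)) • ∑ j, Z (ω j))]
    simp only [map_smul, map_sum]
  simpa only [key, key'] using hmap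

end SampleMean

/-! ### The Kalman step: positivity and smoothness -/

section KalmanStep

variable {H F : Type*} [NormedAddCommGroup H] [InnerProductSpace ℝ H] [CompleteSpace H]
  [NormedAddCommGroup F] [InnerProductSpace ℝ F] [CompleteSpace F]

omit [CompleteSpace H] in
theorem isPositive_of_inner {T : H →L[ℝ] H} (hs : ∀ h h', inner ℝ (T h) h' = inner ℝ h (T h'))
    (hp : ∀ h, 0 ≤ inner ℝ (T h) h) : T.IsPositive :=
  (ContinuousLinearMap.isPositive_iff T).2 ⟨hs, hp⟩

/-- The innovation operator `C P C* + R` is invertible if the noise covariance `R` is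
nondegenerate. -/
theorem isInvertible_innovation [FiniteDimensional ℝ F] {C : H →L[ℝ] F} {P : H →L[ℝ] H}
    {R : F →L[ℝ] F} (hP : P.IsPositive) (hR : ∀ u, inner ℝ (R u) u ≤ 0 → u = 0) :
    (C ∘L P ∘L C.adjoint + R).IsInvertible := by
  have hinj : Function.Injective (C ∘L P ∘L C.adjoint + R) := by
    refine (injective_iff_map_eq_zero _).2 fun u hu => hR u ?_
    have h1 : inner ℝ ((C ∘L P ∘L C.adjoint + R) u) u = 0 := by rw [hu, inner_zero_left]
    -- If the innovation operator kills `u`, then `⟨P C* u, C* u⟩ + ⟨R u, u⟩ = 0`. The first term is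
    -- nonnegative, so `⟨R u, u⟩ ≤ 0`.
    have h2 := hP.inner_nonneg_left (C.adjoint u)
    simp only [add_apply, ContinuousLinearMap.comp_apply, inner_add_left] at h1
    rw [ContinuousLinearMap.adjoint_inner_right] at h2
    linarith
  exact ⟨(LinearEquiv.ofInjectiveEndo (C ∘L P ∘L C.adjoint + R).toLinearMap hinj)
    |>.toContinuousLinearEquiv, by ext; rfl⟩

/-- The posterior covariance `P - P C* (C P C* + R)⁻¹ C P` is positive. -/
theorem isPositive_posterior {C : H →L[ℝ] F} {P : H →L[ℝ] H} {R : F →L[ℝ] F} (hP : P.IsPositive)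
    (hR : R.IsPositive) (hS : (C ∘L P ∘L C.adjoint + R).IsInvertible) :
    ((ContinuousLinearMap.id ℝ H -
      (P ∘L C.adjoint ∘L (C ∘L P ∘L C.adjoint + R).inverse) ∘L C) ∘L P).IsPositive := by
  set S := C ∘L P ∘L C.adjoint + R with hSdef
  have hSpos : S.IsPositive := (hP.conj_adjoint C).add hR
  have hSu : ∀ v, S (S.inverse v) = v := fun v => by
    obtain ⟨e, he⟩ := hS
    rw [← he]; simp
  have hPs := hP.inner_left_eq_inner_right
  have expand : ∀ h h', inner ℝ (((ContinuousLinearMap.id ℝ H -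
      (P ∘L C.adjoint ∘L S.inverse) ∘L C) ∘L P) h) h' =
      inner ℝ (P h) h' - inner ℝ (S.inverse (C (P h))) (S (S.inverse (C (P h')))) := by
    intro h h'
    rw [hSu, ← ContinuousLinearMap.adjoint_inner_left, ← hPs]
    simp [inner_sub_left]
  refine isPositive_of_inner (fun h h' => ?_) fun h => ?_
  · rw [expand, real_inner_comm _ h, expand, hPs, real_inner_comm,
      ← hSpos.inner_left_eq_inner_right, real_inner_comm (S _)]
  · rw [expand]
    set u := S.inverse (C (P h)) with hu
    -- With `u = S⁻¹ C P h`, the quadratic form `⟨P h, h⟩ - ⟨u, S u⟩` of the posterior covariance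
    -- equals `⟨P (h - C* u), h - C* u⟩ + ⟨R u, u⟩`, a sum of two nonnegative terms (Joseph's form).
    have h1 := hP.inner_nonneg_left (h - C.adjoint u)
    have h2 := hR.inner_nonneg_left u
    have h3 : inner ℝ u (S u) = inner ℝ (P (C.adjoint u)) (C.adjoint u) + inner ℝ (R u) u := by
      rw [real_inner_comm, ContinuousLinearMap.adjoint_inner_right]
      simp [hSdef, inner_add_left]
    have h4 : inner ℝ (P h) (C.adjoint u) = inner ℝ u (S u) := by
      rw [ContinuousLinearMap.adjoint_inner_right, hu, hSu, real_inner_comm]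
    have h5 : inner ℝ (P (C.adjoint u)) h = inner ℝ u (S u) := by
      rw [hPs, real_inner_comm, h4]
    simp only [map_sub, inner_sub_left, inner_sub_right] at h1
    linarith

/-- Positivity reproduces itself, since `A P A* + Q` is positive whenever `P` and `Q` are. It keeps
the innovation operator of the exact filter invertible at every step. -/
theorem isPositive_kalman [FiniteDimensional ℝ F] {A : H →L[ℝ] H} {C : H →L[ℝ] F}
    {Q : ℕ → H →L[ℝ] H} {R : ℕ → F →L[ℝ] F} {y : ℕ → F} {s₀ : H × (H →L[ℝ] H)}
    (hQ : ∀ k, (Q k).IsPositive) (hR : ∀ k, (R k).IsPositive)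
    (hR' : ∀ k u, inner ℝ (R k u) u ≤ 0 → u = 0) (h₀ : s₀.2.IsPositive) (k : ℕ) :
    (kalman A C Q R y s₀ k).2.IsPositive := by
  induction k with
  | zero => exact h₀
  | succ k ih =>
    have hP := (ih.conj_adjoint A).add (hQ (k + 1))
    exact isPositive_posterior hP (hR _) (isInvertible_innovation hP (hR' _))

theorem differentiable_adjoint :
    Differentiable ℝ (fun T : H →L[ℝ] F => T.adjoint) := by
  have : IsBoundedLinearMap ℝ (fun T : H →L[ℝ] F => T.adjoint) :=
    IsBoundedLinearMap.mk ⟨fun _ _ => map_add _ _ _, fun _ _ => by simp⟩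
      ⟨1, one_pos, fun T => by simp⟩
  exact this.differentiable

@[fun_prop]
theorem DifferentiableAt.clm_adjoint {E : Type*} [NormedAddCommGroup E] [NormedSpace ℝ E]
    {T : E → H →L[ℝ] F} {a : E} (hT : DifferentiableAt ℝ T a) :
    DifferentiableAt ℝ (fun e => (T e).adjoint) a :=
  DifferentiableAt.comp a (differentiable_adjoint (T a)) hT

/-- Invertible operators form an open set on which inversion is smooth, so the value `0` of
`inverse` off this set plays no role. -/
theorem differentiableAt_inverse {E : Type*} [NormedAddCommGroup E] [NormedSpace ℝ E]
    {T : E → F →L[ℝ] F} {a : E} (hT : DifferentiableAt ℝ T a) (ha : (T a).IsInvertible) :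
    DifferentiableAt ℝ (fun e => (T e).inverse) a :=
  DifferentiableAt.comp a ((ha.contDiffAt_map_inverse (n := 1)).differentiableAt one_ne_zero) hT

/-- The Kalman step is differentiable in all its inputs where the innovation operator is
invertible. -/
theorem differentiableAt_kalmanStep (y : F)
    {a : (H →L[ℝ] H) × (H →L[ℝ] F) × (H →L[ℝ] H) × (F →L[ℝ] F) × H × (H →L[ℝ] H)}
    (ha : (a.2.1 ∘L (a.1 ∘L a.2.2.2.2.2 ∘L a.1.adjoint + a.2.2.1) ∘L a.2.1.adjoint
      + a.2.2.2.1).IsInvertible) :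
    DifferentiableAt ℝ (fun t : (H →L[ℝ] H) × (H →L[ℝ] F) × (H →L[ℝ] H) × (F →L[ℝ] F) ×
      H × (H →L[ℝ] H) => kalmanStep t.1 t.2.1 t.2.2.1 t.2.2.2.1 y t.2.2.2.2) a := by
  have hm : DifferentiableAt ℝ (fun t : (H →L[ℝ] H) × (H →L[ℝ] F) × (H →L[ℝ] H) ×
      (F →L[ℝ] F) × H × (H →L[ℝ] H) => t.1 t.2.2.2.2.1) a := by fun_prop
  have hP : DifferentiableAt ℝ (fun t : (H →L[ℝ] H) × (H →L[ℝ] F) × (H →L[ℝ] H) ×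
      (F →L[ℝ] F) × H × (H →L[ℝ] H) => t.1 ∘L t.2.2.2.2.2 ∘L t.1.adjoint + t.2.2.1) a := by
    fun_prop
  have hCa : DifferentiableAt ℝ (fun t : (H →L[ℝ] H) × (H →L[ℝ] F) × (H →L[ℝ] H) ×
      (F →L[ℝ] F) × H × (H →L[ℝ] H) => t.2.1.adjoint) a := by fun_prop
  have hC : DifferentiableAt ℝ (fun t : (H →L[ℝ] H) × (H →L[ℝ] F) × (H →L[ℝ] H) ×
      (F →L[ℝ] F) × H × (H →L[ℝ] H) => t.2.1) a := by fun_prop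
  have hR : DifferentiableAt ℝ (fun t : (H →L[ℝ] H) × (H →L[ℝ] F) × (H →L[ℝ] H) ×
      (F →L[ℝ] F) × H × (H →L[ℝ] H) => t.2.2.2.1) a := by fun_prop
  have hS := differentiableAt_inverse ((hC.clm_comp (hP.clm_comp hCa)).add hR) ha
  have hK := hP.clm_comp (hCa.clm_comp hS)
  exact (hm.add (hK.clm_apply ((differentiableAt_const y).sub (hC.clm_apply hm)))).prodMk
    (((differentiableAt_const _).sub (hK.clm_comp hC)).clm_comp hP)

/-- Consistency of the inputs of the Kalman recursion is inherited by its iterates. -/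
theorem RootNClose.kalman [FiniteDimensional ℝ F]
    {Ω : ℕ → Type*} [∀ N, MeasurableSpace (Ω N)] {P : ∀ N, Measure (Ω N)}
    {A : ∀ N, Ω N → H →L[ℝ] H} {a : H →L[ℝ] H} {C : ∀ N, Ω N → H →L[ℝ] F} {c : H →L[ℝ] F}
    {Q : ∀ N, Ω N → ℕ → H →L[ℝ] H} {q : ℕ → H →L[ℝ] H}
    {R : ∀ N, Ω N → ℕ → F →L[ℝ] F} {r : ℕ → F →L[ℝ] F} (y : ℕ → F)
    {σ : ∀ N, Ω N → H × (H →L[ℝ] H)} {s₀ : H × (H →L[ℝ] H)}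
    (hA : RootNClose P A a) (hC : RootNClose P C c)
    (hQ : ∀ k, RootNClose P (fun N s => Q N s k) (q k))
    (hR : ∀ k, RootNClose P (fun N s => R N s k) (r k)) (hσ : RootNClose P σ s₀)
    (hq : ∀ k, (q k).IsPositive) (hr : ∀ k, (r k).IsPositive)
    (hr' : ∀ k u, inner ℝ (r k u) u ≤ 0 → u = 0) (h₀ : s₀.2.IsPositive) (k : ℕ) :
    RootNClose P (fun N s => KKF.kalman (A N s) (C N s) (Q N s) (R N s) y (σ N s) k)
      (KKF.kalman a c q r y s₀ k) := by
  induction k with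
  | zero => exact hσ
  | succ k ih =>
    -- Only the predicted covariance of the exact filter has to be positive, because the delta
    -- method asks for differentiability at the limit alone.
    have hP := ((isPositive_kalman hq hr hr' h₀ k (A := a) (C := c) (y := y)).conj_adjoint a).add
      (hq (k + 1))
    exact (hA.prodMk <| hC.prodMk <| (hQ (k + 1)).prodMk <| (hR (k + 1)).prodMk ih).map
      (differentiableAt_kalmanStep (y (k + 1)) (isInvertible_innovation hP (hr' _)))

end KalmanStep

/-! ### Covariances and sample covariances -/

section Covariance

variable {Ω K : Type*} [MeasurableSpace Ω] [NormedAddCommGroup K] [InnerProductSpace ℝ K]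
  {P : Measure Ω} [IsProbabilityMeasure P]

theorem differentiable_rankOne {L : Type*} [NormedAddCommGroup L] [InnerProductSpace ℝ L] :
    Differentiable ℝ fun q : K × L => rankOne ℝ q.1 q.2 := by
  have : IsBoundedBilinearMap ℝ fun q : K × L => rankOne ℝ q.1 q.2 :=
    { add_left := by simp
      smul_left := by simp
      add_right := by simp
      smul_right := by simp
      bound := ⟨1, one_pos, fun x y => by rw [norm_rankOne, one_mul]⟩ }
  exact this.differentiable

theorem aestronglyMeasurable_rankOne {L : Type*} [NormedAddCommGroup L] [InnerProductSpace ℝ L]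
    {P : Measure Ω} {Z : Ω → K} {W : Ω → L} (hZ : AEStronglyMeasurable Z P)
    (hW : AEStronglyMeasurable W P) :
    AEStronglyMeasurable (fun ω => rankOne ℝ (Z ω) (W ω)) P := by
  have hc := (differentiable_rankOne (K := K) (L := L)).continuous
  have h := hc.comp_aestronglyMeasurable (hZ.prodMk hW)
  exact h

variable [CompleteSpace K]

/-- The weak form reduces symmetry, positivity and expansion of the covariance operator to scalar
integrals. -/
theorem inner_covOp {Z : Ω → K} (hZ : AEStronglyMeasurable Z P) {M : ℝ}
    (hM : ∀ᵐ ω ∂P, ‖Z ω‖ ≤ M) (u v : K) :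
    inner ℝ (covOp P Z u) v =
      ∫ ω, inner ℝ (Z ω - ∫ ω', Z ω' ∂P) u * inner ℝ (Z ω - ∫ ω', Z ω' ∂P) v ∂P := by
  set m := ∫ ω', Z ω' ∂P
  have hint : Integrable (fun ω => rankOne ℝ (Z ω - m) (Z ω - m)) P := by
    have hZm := hZ.sub (aestronglyMeasurable_const (b := m))
    refine .of_bound (aestronglyMeasurable_rankOne hZm hZm) ((M + ‖m‖) * (M + ‖m‖))
      (hM.mono fun ω hω => ?_)
    rw [norm_rankOne]
    have := (norm_sub_le (Z ω) m).trans (add_le_add_left hω _)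
    exact mul_self_le_mul_self (norm_nonneg _) this
  rw [covOp, ContinuousLinearMap.integral_apply hint, real_inner_comm,
    ← integral_inner (hint.apply_continuousLinearMap u)]
  congr 1 with ω
  simp only [rankOne_apply, inner_smul_right]
  rw [real_inner_comm v]

theorem isPositive_covOp {Z : Ω → K} (hZ : AEStronglyMeasurable Z P) {M : ℝ}
    (hM : ∀ᵐ ω ∂P, ‖Z ω‖ ≤ M) : (covOp P Z).IsPositive := by
  refine isPositive_of_inner (fun u v => ?_) fun u => ?_
  · rw [real_inner_comm _ u, inner_covOp hZ hM, inner_covOp hZ hM]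
    simp only [mul_comm]
  · rw [inner_covOp hZ hM]
    exact integral_nonneg fun ω => mul_self_nonneg _

/-- This presents the covariance as a smooth function of the two means `E[Z ⊗ Z]` and `E Z`, to
which the delta method applies. -/
theorem covOp_eq {Z : Ω → K} (hZ : AEStronglyMeasurable Z P) {M : ℝ}
    (hM : ∀ᵐ ω ∂P, ‖Z ω‖ ≤ M) :
    covOp P Z = ∫ ω, rankOne ℝ (Z ω) (Z ω) ∂P - rankOne ℝ (∫ ω, Z ω ∂P) (∫ ω, Z ω ∂P) := by
  have hint : Integrable Z P := .of_bound hZ M hM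
  have hint2 : Integrable (fun ω => rankOne ℝ (Z ω) (Z ω)) P := by
    refine .of_bound (aestronglyMeasurable_rankOne hZ hZ) (M * M) (hM.mono fun ω hω => ?_)
    rw [norm_rankOne]
    gcongr
    exact (norm_nonneg _).trans hω
  ext u
  refine ext_inner_right ℝ fun v => ?_
  rw [inner_covOp hZ hM]
  set m := ∫ ω, Z ω ∂P with hm
  have i1 : Integrable (fun ω => inner ℝ (Z ω) u) P := hint.inner_const u
  have i2 : Integrable (fun ω => inner ℝ (Z ω) v) P := hint.inner_const v
  have i3 : Integrable (fun ω => inner ℝ (Z ω) u * inner ℝ (Z ω) v) P := by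
    refine ((hint2.apply_continuousLinearMap u).inner_const v).congr (.of_forall fun ω => ?_)
    simp [inner_smul_left]
  have e1 : ∫ ω, inner ℝ (Z ω) u ∂P = inner ℝ m u := by
    simp_rw [fun ω => real_inner_comm u (Z ω)]
    rw [integral_inner hint, real_inner_comm]
  have e2 : ∫ ω, inner ℝ (Z ω) v ∂P = inner ℝ m v := by
    simp_rw [fun ω => real_inner_comm v (Z ω)]
    rw [integral_inner hint, real_inner_comm]
  have e3 : inner ℝ ((∫ ω, rankOne ℝ (Z ω) (Z ω) ∂P) u) v =
      ∫ ω, inner ℝ (Z ω) u * inner ℝ (Z ω) v ∂P := by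
    rw [ContinuousLinearMap.integral_apply hint2, real_inner_comm,
      ← integral_inner (hint2.apply_continuousLinearMap u)]
    congr 1 with ω
    simp only [rankOne_apply, inner_smul_right]
    rw [real_inner_comm v]
  have e4 : ∀ ω, inner ℝ (Z ω - m) u * inner ℝ (Z ω - m) v = inner ℝ (Z ω) u * inner ℝ (Z ω) v
      - inner ℝ (Z ω) u * inner ℝ m v - inner ℝ m u * inner ℝ (Z ω) v
      + inner ℝ m u * inner ℝ m v := fun ω => by
    simp only [inner_sub_left]; ring
  simp_rw [e4]
  have i4 : Integrable (fun ω => inner ℝ (Z ω) u * inner ℝ (Z ω) v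
      - inner ℝ (Z ω) u * inner ℝ m v) P := i3.sub (i1.mul_const _)
  have i5 : Integrable (fun ω => inner ℝ (Z ω) u * inner ℝ (Z ω) v
      - inner ℝ (Z ω) u * inner ℝ m v - inner ℝ m u * inner ℝ (Z ω) v) P :=
    i4.sub (i2.const_mul _)
  rw [integral_add i5 (integrable_const _), integral_sub i4 (i2.const_mul _),
    integral_sub i3 (i1.mul_const _),
    integral_mul_const, integral_const_mul, e1, e2]
  simp only [sub_apply, inner_sub_left, e3, rankOne_apply, inner_smul_left, integral_const,
    probReal_univ, one_smul]
  simp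

-- The empirical counterpart of `covOp_eq`; the factor `N / (N - 1)` comes from the unbiased
-- normalisation.
omit [CompleteSpace K] in
theorem sampleCov_eq {N : ℕ} (hN : 0 < N) (z : Fin N → K) :
    sampleCov z = ((N : ℝ) / ((N : ℝ) - 1)) •
      ((1 / (N : ℝ)) • ∑ j, rankOne ℝ (z j) (z j)
        - rankOne ℝ (sampleMean z) (sampleMean z)) := by
  have hN' : (N : ℝ) ≠ 0 := by positivity
  have hsum : ∑ j, z j = (N : ℝ) • sampleMean z := by
    rw [sampleMean, smul_smul, mul_one_div_cancel hN', one_smul]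
  have h1 : ∑ j, rankOne ℝ (z j) (sampleMean z) =
      (N : ℝ) • rankOne ℝ (sampleMean z) (sampleMean z) := by
    rw [← sum_apply, ← map_sum, hsum]; simp
  have h2 : ∑ j, rankOne ℝ (sampleMean z) (z j) =
      (N : ℝ) • rankOne ℝ (sampleMean z) (sampleMean z) := by
    rw [← map_sum, hsum]; simp
  have h3 : ∑ j, rankOne ℝ (z j - sampleMean z) (z j - sampleMean z) =
      ∑ j, rankOne ℝ (z j) (z j) - (N : ℝ) • rankOne ℝ (sampleMean z) (sampleMean z) := by
    simp only [map_sub, sub_apply, Finset.sum_sub_distrib, h1, h2]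
    rw [Finset.sum_const, Finset.card_univ, Fintype.card_fin, ← Nat.cast_smul_eq_nsmul ℝ]
    abel
  rw [sampleCov, h3, smul_sub, smul_sub, smul_smul, smul_smul]
  congr 2
  · field_simp
  · ring

omit [CompleteSpace K] in
/-- Sample means are `√N`-consistent. -/
theorem rootNClose_sampleMean [FiniteDimensional ℝ K] {Z : Ω → K} (hZ : AEStronglyMeasurable Z P)
    {M : ℝ} (hM : ∀ᵐ ω ∂P, ‖Z ω‖ ≤ M) :
    RootNClose (fun N => Measure.pi fun _ : Fin N => P)
      (fun _ ω => sampleMean fun j => Z (ω j)) (∫ ω, Z ω ∂P) :=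
  rootNClose_mean hZ hM

/-- Sample covariances are `√N`-consistent. -/
theorem rootNClose_sampleCov [FiniteDimensional ℝ K] {Z : Ω → K} (hZ : AEStronglyMeasurable Z P)
    {M : ℝ} (hM : ∀ᵐ ω ∂P, ‖Z ω‖ ≤ M) :
    RootNClose (fun N => Measure.pi fun _ : Fin N => P)
      (fun _ ω => sampleCov fun j => Z (ω j)) (covOp P Z) := by
  have hmean := rootNClose_sampleMean hZ hM
  have hsq : RootNClose (fun N => Measure.pi fun _ : Fin N => P)
      (fun N ω => (1 / (N : ℝ)) • ∑ j, rankOne ℝ (Z (ω j)) (Z (ω j)))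
      (∫ ω, rankOne ℝ (Z ω) (Z ω) ∂P) := by
    refine rootNClose_mean (Z := fun ω => rankOne ℝ (Z ω) (Z ω))
      (aestronglyMeasurable_rankOne hZ hZ) (M := M * M) (hM.mono fun ω hω => ?_)
    rw [norm_rankOne]
    gcongr
    exact (norm_nonneg _).trans hω
  have hscal : RootNClose (fun N => Measure.pi fun _ : Fin N => P)
      (fun N _ => (N : ℝ) / ((N : ℝ) - 1)) 1 := by
    -- The deviation from `1` is `1 / (N - 1) ≤ 2 / N = 2 * rate N ^ 2 ≤ 2 * rate N` for `N ≥ 2`.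
    refine .of_deterministic (C := 2) ((eventually_ge_atTop 2).mono fun N hN => ?_)
    have hN' : (2 : ℝ) ≤ N := by exact_mod_cast hN
    have h1 : (N : ℝ) / ((N : ℝ) - 1) - 1 = 1 / ((N : ℝ) - 1) := by
      have : (N : ℝ) - 1 ≠ 0 := by linarith
      field_simp
      ring
    have h2 : rate N ^ 2 ≤ rate N := by
      have h3 : rate N ≤ 1 := Real.rpow_le_one_of_one_le_of_nonpos (by linarith) (by norm_num)
      nlinarith [rate_nonneg N]
    rw [h1, Real.norm_of_nonneg (by apply div_nonneg <;> linarith)]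
    refine le_trans ?_ (mul_le_mul_of_nonneg_left h2 zero_le_two)
    rw [rate_sq, div_le_iff₀ (by linarith)]
    field_simp
    linarith
  let φ : ℝ × (K →L[ℝ] K) × K → K →L[ℝ] K := fun t => t.1 • (t.2.1 - rankOne ℝ t.2.2 t.2.2)
  have hφ : Differentiable ℝ φ := by
    have : Differentiable ℝ fun t : ℝ × (K →L[ℝ] K) × K => rankOne ℝ t.2.2 t.2.2 :=
      differentiable_rankOne.comp (g := fun q : K × K => rankOne ℝ q.1 q.2)
        (f := fun t : ℝ × (K →L[ℝ] K) × K => (t.2.2, t.2.2)) (by fun_prop)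
    unfold φ
    fun_prop
  have h := (hscal.prodMk (hsq.prodMk hmean)).map (hφ _)
  have hlim : φ (1, ∫ ω, rankOne ℝ (Z ω) (Z ω) ∂P, ∫ ω, Z ω ∂P) = covOp P Z := by
    rw [covOp_eq hZ hM]; simp [φ]
  rw [hlim] at h
  -- The sample covariance agrees with `φ` of the means once `N > 0`, so the transfer is with
  -- constant `1`.
  refine h.of_calm one_pos zero_le_one ((eventually_gt_atTop 0).mono fun N hN s _ => ?_)
  rw [sampleCov_eq hN, one_mul]

end Covariance

/-! ### The feature map and the autocovariance operator -/

section Features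

variable {n : ℕ} {𝒳 : Set (Euc n)}
  {H : Type*} [NormedAddCommGroup H] [InnerProductSpace ℝ H] [CompleteSpace H] [RKHS ℝ H 𝒳 ℝ]

theorem inner_feat (x : 𝒳) (ψ : H) : inner ℝ (feat H x) ψ = ψ x := by
  simp [feat]

theorem ker_eq_inner (x x' : 𝒳) : ker H x x' = inner ℝ (feat H x) (feat H x') := by
  rw [inner_feat, feat, RKHS.kerFun_apply, ker]

/-- Expanding `‖φ x - φ x₀‖ ^ 2` expresses the distance through the kernel alone. -/
theorem continuous_of_continuous_inner {X E : Type*} [TopologicalSpace X] [NormedAddCommGroup E]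
    [InnerProductSpace ℝ E] {φ : X → E}
    (h : Continuous fun q : X × X => (inner ℝ (φ q.1) (φ q.2) : ℝ)) : Continuous φ := by
  refine continuous_iff_continuousAt.2 fun x₀ => tendsto_iff_norm_sub_tendsto_zero.2 ?_
  have c1 : Continuous fun x => (inner ℝ (φ x) (φ x) : ℝ) :=
    h.comp (continuous_id.prodMk continuous_id)
  have c2 : Continuous fun x => (inner ℝ (φ x) (φ x₀) : ℝ) :=
    h.comp (continuous_id.prodMk continuous_const)
  have c3 : Continuous fun x => ‖φ x - φ x₀‖ := by
    have : ∀ x, ‖φ x - φ x₀‖ = √(inner ℝ (φ x) (φ x) - 2 * inner ℝ (φ x) (φ x₀) +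
        inner ℝ (φ x₀) (φ x₀)) := fun x => by
      rw [real_inner_self_eq_norm_sq, real_inner_self_eq_norm_sq, ← norm_sub_sq_real,
        Real.sqrt_sq (norm_nonneg _)]
    simp_rw [this]
    fun_prop
  simpa using c3.tendsto x₀

theorem continuous_feat (hk : Continuous fun q : 𝒳 × 𝒳 => ker H q.1 q.2) :
    Continuous (feat H : 𝒳 → H) :=
  continuous_of_continuous_inner (by simpa only [ker_eq_inner] using hk)

theorem exists_norm_feat_le (h𝒳 : IsCompact 𝒳) (hc : Continuous (feat H : 𝒳 → H)) :
    ∃ M, 0 ≤ M ∧ ∀ x : 𝒳, ‖feat H x‖ ≤ M := by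
  have : CompactSpace 𝒳 := isCompact_iff_compactSpace.1 h𝒳
  obtain ⟨M, hM⟩ := (isCompact_range hc).isBounded.exists_norm_le
  exact ⟨max M 0, le_max_right _ _, fun x => (hM _ ⟨x, rfl⟩).trans (le_max_left _ _)⟩

theorem featExt_coe (x : 𝒳) : featExt H (x : Euc n) = feat H x :=
  Subtype.val_injective.extend_apply _ _ _

theorem featExt_of_notMem {z : Euc n} (hz : z ∉ 𝒳) : featExt (𝒳 := 𝒳) H z = 0 :=
  Function.extend_apply' _ _ _ (by rintro ⟨x, rfl⟩; exact hz x.2)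

theorem inner_featExt (z : Euc n) (ψ : H) :
    inner ℝ (featExt H z) ψ = Function.extend Subtype.val (ψ : 𝒳 → ℝ) 0 z := by
  by_cases hz : z ∈ 𝒳
  · lift z to 𝒳 using hz
    rw [featExt_coe, inner_feat, Subtype.val_injective.extend_apply]
  · rw [featExt_of_notMem hz, inner_zero_left, Function.extend_apply' _ _ _
      (by rintro ⟨x, rfl⟩; exact hz x.2), Pi.zero_apply]

theorem norm_featExt_le {M : ℝ} (hM₀ : 0 ≤ M) (hM : ∀ x : 𝒳, ‖feat H x‖ ≤ M) (z : Euc n) :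
    ‖featExt (𝒳 := 𝒳) H z‖ ≤ M := by
  by_cases hz : z ∈ 𝒳
  · lift z to 𝒳 using hz
    rw [featExt_coe]; exact hM z
  · rwa [featExt_of_notMem hz, norm_zero]

theorem stronglyMeasurable_featExt (h𝒳 : IsCompact 𝒳) (hc : Continuous (feat H : 𝒳 → H)) :
    StronglyMeasurable (featExt H : Euc n → H) :=
  (MeasurableEmbedding.subtype_coe h𝒳.measurableSet).stronglyMeasurable_extend
    hc.stronglyMeasurable stronglyMeasurable_const

variable {μ : Measure 𝒳} [IsProbabilityMeasure μ]

theorem integrable_rankOne_feat (hc : Continuous (feat H : 𝒳 → H)) {M : ℝ}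
    (hM : ∀ x : 𝒳, ‖feat H x‖ ≤ M) :
    Integrable (fun x : 𝒳 => rankOne ℝ (feat H x) (feat H x)) μ := by
  refine .of_bound (aestronglyMeasurable_rankOne hc.aestronglyMeasurable hc.aestronglyMeasurable)
    (M * M) (.of_forall fun x => ?_)
  rw [norm_rankOne]
  exact mul_self_le_mul_self (norm_nonneg _) (hM x)

theorem covX_apply (hc : Continuous (feat H : 𝒳 → H)) {M : ℝ}
    (hM : ∀ x : 𝒳, ‖feat H x‖ ≤ M) (ψ : H) : covX H μ ψ = ∫ x, ψ x • feat H x ∂μ := by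
  rw [covX, ContinuousLinearMap.integral_apply (integrable_rankOne_feat hc hM)]
  simp [inner_feat]

/-- A continuous-kernel RKHS whose autocovariance operator is bounded below is finite-dimensional,
since that operator is compact. -/
theorem finiteDimensional_of_covX (hc : Continuous (feat H : 𝒳 → H)) {M : ℝ}
    (hM : ∀ x : 𝒳, ‖feat H x‖ ≤ M) {c₁ : ℝ} (hc₁ : 0 < c₁)
    (hcoer : ∀ ψ : H, c₁ * ‖ψ‖ ≤ ‖covX H μ ψ‖) : FiniteDimensional ℝ H := by
  have hcpt : IsCompactOperator (covX H μ) := by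
    -- The compact operators form a closed convex set, and an average of compact operators over a
    -- probability measure stays in it.
    have hmem : covX H μ ∈ {T : H →L[ℝ] H | IsCompactOperator T} := by
      refine Convex.integral_mem (fun S hS T hT a b _ _ _ => ?_)
        isClosed_setOfPred_isCompactOperator (.of_forall fun x => ?_) (integrable_rankOne_feat hc hM)
      · exact (hS.smul a).add (hT.smul b)
      · have : IsCompactOperator (ContinuousLinearMap.toSpanSingleton ℝ (feat H x) ∘L
            innerSL ℝ (feat H x)) :=
          (isCompactOperator_id (E := ℝ)).clm_comp (ContinuousLinearMap.toSpanSingleton ℝ (feat H x))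
            |>.comp_clm (innerSL ℝ (feat H x))
        exact this
    exact hmem
  have hanti : AntilipschitzWith (Real.toNNReal c₁⁻¹) (covX H μ) := by
    refine ContinuousLinearMap.antilipschitz_of_bound _ fun ψ => ?_
    rw [Real.coe_toNNReal _ (by positivity), inv_mul_eq_div, le_div_iff₀ hc₁, mul_comm]
    exact hcoer ψ
  -- Some compact `K` has a preimage under `C_X` that is a neighbourhood of `0`. As a map bounded
  -- below is a closed embedding, this preimage is itself compact, so the identity of `H` is a
  -- compact operator.
  obtain ⟨K, hK, hK'⟩ := hcpt
  refine (isCompactOperator_id_iff_finiteDimensional (𝕜 := ℝ)).1 ⟨covX H μ ⁻¹' K, ?_, hK'⟩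
  exact (hanti.isClosedEmbedding (covX H μ).uniformContinuous).isCompact_preimage hK

omit [IsProbabilityMeasure μ] in
theorem isInvertible_covX [FiniteDimensional ℝ H] {c₁ : ℝ} (hc₁ : 0 < c₁)
    (hcoer : ∀ ψ : H, c₁ * ‖ψ‖ ≤ ‖covX H μ ψ‖) : (covX H μ).IsInvertible := by
  have hinj : Function.Injective (covX H μ) := by
    refine (injective_iff_map_eq_zero _).2 fun ψ hψ => ?_
    have := hcoer ψ
    rw [hψ, norm_zero] at this
    exact norm_le_zero_iff.1 (by nlinarith [norm_nonneg ψ])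
  exact ⟨(LinearEquiv.ofInjectiveEndo (covX H μ).toLinearMap hinj).toContinuousLinearEquiv,
    by ext; rfl⟩

/-- An operator into functions on `𝒳` given by bounded representers, with values in `H`, is a
bounded operator into `H` if the autocovariance operator is bounded below. -/
theorem toRKHS_apply (hc : Continuous (feat H : 𝒳 → H)) {M : ℝ}
    (hM : ∀ x : 𝒳, ‖feat H x‖ ≤ M) {c₁ : ℝ} (hc₁ : 0 < c₁)
    (hcoer : ∀ ψ : H, c₁ * ‖ψ‖ ≤ ‖covX H μ ψ‖) {D : Type*} [NormedAddCommGroup D]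
    [InnerProductSpace ℝ D] {𝒯 : D → 𝒳 → ℝ} {m : 𝒳 → D} {B : ℝ} (hm : ∀ x, ‖m x‖ ≤ B)
    (h𝒯 : ∀ d x, 𝒯 d x = inner ℝ (m x) d) (hinto : MapsInto H 𝒯) (d : D) (x : 𝒳) :
    toRKHS H 𝒯 d x = 𝒯 d x := by
  have hex : ∃ A : D →L[ℝ] H, ∀ d x, A d x = 𝒯 d x := by
    -- Elements of `H` are determined by their values, so the choice is automatically linear. For
    -- boundedness, `C_X (a d) = E[(𝒯 d)(X) Φ(X)]` has norm at most `B ‖d‖ M`, and coercivity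
    -- divides this by `c₁`.
    choose a ha using hinto
    refine ⟨LinearMap.mkContinuous ⟨⟨a, fun d e => ?_⟩, fun r d => ?_⟩ (c₁⁻¹ * (B * M))
      fun d => ?_, ha⟩
    · ext x; simp [ha, h𝒯, inner_add_right]
    · ext x; simp [ha, h𝒯, inner_smul_right]
    · have h1 : ‖covX H μ (a d)‖ ≤ B * ‖d‖ * M := by
        rw [covX_apply hc hM]
        refine (norm_integral_le_of_norm_le_const (C := B * ‖d‖ * M)
          (.of_forall fun x => ?_)).trans (by simp)
        rw [norm_smul, ha, h𝒯]
        have hB : 0 ≤ B := (norm_nonneg _).trans (hm x)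
        gcongr
        · exact (norm_inner_le_norm _ _).trans (by gcongr; exact hm x)
        · exact hM x
      have h2 := (hcoer (a d)).trans h1
      simp only [LinearMap.coe_mk, AddHom.coe_mk]
      rw [mul_assoc, inv_mul_eq_div, le_div_iff₀ hc₁]
      linarith
  rw [toRKHS, dif_pos hex]
  exact hex.choose_spec d x

/-- The normal equation: if `A q` is the conditional expectation of `⟨q, Z⟩` given the state, then
`C_X A` is the cross-covariance operator `E[Φ(X) ⊗ Z]`. -/
theorem covX_comp_eq (hc : Continuous (feat H : 𝒳 → H)) {M : ℝ}
    (hM : ∀ x : 𝒳, ‖feat H x‖ ≤ M) {Ω K : Type*} [MeasurableSpace Ω] {P : Measure Ω}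
    [IsProbabilityMeasure P] [NormedAddCommGroup K] [InnerProductSpace ℝ K]
    {Z : 𝒳 × Ω → K} (hint : Integrable (fun q => rankOne ℝ (feat H q.1) (Z q)) (μ.prod P))
    {A : K →L[ℝ] H} (hA : ∀ q x, A q x = ∫ ω, inner ℝ q (Z (x, ω)) ∂P) :
    covX H μ ∘L A = ∫ q, rankOne ℝ (feat H q.1) (Z q) ∂(μ.prod P) := by
  ext q : 1
  have hint' := hint.apply_continuousLinearMap q
  rw [ContinuousLinearMap.comp_apply, covX_apply hc hM, ContinuousLinearMap.integral_apply hint,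
    integral_prod _ hint']
  congr 1 with x
  simp only [rankOne_apply]
  rw [integral_smul_const, hA]
  simp_rw [real_inner_comm]

end Features

/-! ### Empirical regression operators -/

section Regression

variable {n N : ℕ} {𝒳 : Set (Euc n)}
  {H : Type*} [NormedAddCommGroup H] [InnerProductSpace ℝ H] [CompleteSpace H] [RKHS ℝ H 𝒳 ℝ]
  {K : Type*} [NormedAddCommGroup K] [InnerProductSpace ℝ K]

/-- If `C_X^N h = 0`, then `(1/N) ∑_j ⟨Φ(x_j), h⟩² = 0`, so `h` is orthogonal to the span that
contains it. This holds for every sample, with repeated points or without. -/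
theorem isInvertible_empCovX (ξ : Fin N → 𝒳) : (empCovX H ξ).IsInvertible := by
  have : FiniteDimensional ℝ (empSpan H ξ) :=
    FiniteDimensional.span_of_finite ℝ (Set.finite_range _)
  have hinj : Function.Injective (empCovX H ξ) := by
    refine (injective_iff_map_eq_zero _).2 fun h hh => ?_
    have h0 : empCov H ξ (fun j => feat H (ξ j)) (h : H) = 0 := congrArg Subtype.val hh
    have h1 : inner ℝ (empCov H ξ (fun j => feat H (ξ j)) (h : H)) (h : H) = 0 := by
      rw [h0, inner_zero_left]
    have horth : ∀ j, inner ℝ (feat H (ξ j)) (h : H) = 0 := by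
      intro j
      have hN : (N : ℝ) ≠ 0 := by
        have := j.pos
        positivity
      simp only [empCov, smul_apply, sum_apply, rankOne_apply, inner_smul_left, sum_inner] at h1
      have h2 := (mul_eq_zero.1 h1).resolve_left (by simpa using hN)
      have h3 := (Finset.sum_eq_zero_iff_of_nonneg fun i _ => ?_).1 h2 j (Finset.mem_univ j)
      · simpa using h3
      · simpa using mul_self_nonneg _
    have hspan : ∀ v ∈ empSpan H ξ, inner ℝ v (h : H) = 0 := by
      intro v hv
      induction hv using Submodule.span_induction with
      | mem v hv => obtain ⟨j, rfl⟩ := hv; exact horth j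
      | zero => exact inner_zero_left _
      | add v w _ _ hv hw => rw [inner_add_left, hv, hw, add_zero]
      | smul r v _ hv => rw [inner_smul_left, hv, mul_zero]
    exact Subtype.ext (inner_self_eq_zero.1 (hspan h h.2))
  exact ⟨(LinearEquiv.ofInjectiveEndo (empCovX H ξ).toLinearMap hinj).toContinuousLinearEquiv,
    by ext; rfl⟩

/-- The empirical normal equation. -/
theorem empCov_empRegress (ξ : Fin N → 𝒳) (z : Fin N → K) (u : K) :
    empCov H ξ (fun j => feat H (ξ j)) (empRegress H ξ z u) = empCov H ξ z u := by
  obtain ⟨e, he⟩ := isInvertible_empCovX (H := H) ξ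
  set b : empSpan H ξ := (empCov H ξ z).codRestrict (empSpan H ξ) (empCov_mem H ξ z) u
  have h : empCovX H ξ ((empCovX H ξ).inverse b) = b := by
    rw [← he]; simp
  exact congrArg Subtype.val h

/-- Subtracting the normal equations gives `C_X E = G - D A - D E` for the error `E`, with `D` and
`G` the errors of the two covariances. By coercivity `c₁ ‖E u‖ ≤ ‖C_X E u‖`, and `‖D‖ ≤ c₁ / 2` lets
the last term be absorbed on the left. `C_X^N` need not be invertible on all of `H`. -/
theorem norm_empRegress_sub_le {μ : Measure 𝒳} {c₁ : ℝ} (hc₁ : 0 < c₁)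
    (hcoer : ∀ ψ : H, c₁ * ‖ψ‖ ≤ ‖covX H μ ψ‖) (ξ : Fin N → 𝒳) (z : Fin N → K) (A : K →L[ℝ] H)
    (hclose : ‖empCov H ξ (fun j => feat H (ξ j)) - covX H μ‖ ≤ c₁ / 2) :
    ‖empRegress H ξ z - A‖ ≤ 2 / c₁ * (‖A‖ * ‖empCov H ξ (fun j => feat H (ξ j)) - covX H μ‖ +
      ‖empCov H ξ z - covX H μ ∘L A‖) := by
  set D := empCov H ξ (fun j => feat H (ξ j)) - covX H μ with hD
  set G := empCov H ξ z - covX H μ ∘L A with hG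
  refine ContinuousLinearMap.opNorm_le_bound _ (by positivity) fun u => ?_
  have hdecomp : covX H μ ((empRegress H ξ z - A) u) =
      G u - D (A u) - D ((empRegress H ξ z - A) u) := by
    have := empCov_empRegress (H := H) ξ z u
    simp only [hD, hG, sub_apply, ContinuousLinearMap.comp_apply, map_sub, this]
    abel
  have h1 := hcoer ((empRegress H ξ z - A) u)
  rw [hdecomp] at h1
  have h2 : ‖G u - D (A u) - D ((empRegress H ξ z - A) u)‖ ≤ ‖G‖ * ‖u‖ + ‖D‖ * (‖A‖ * ‖u‖) +
      c₁ / 2 * ‖(empRegress H ξ z - A) u‖ := by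
    refine (norm_sub_le _ _).trans (add_le_add ((norm_sub_le _ _).trans
      (add_le_add (G.le_opNorm u) ((D.le_opNorm _).trans ?_))) ((D.le_opNorm _).trans ?_))
    · gcongr; exact A.le_opNorm u
    · gcongr
  have h3 : c₁ / 2 * ‖(empRegress H ξ z - A) u‖ ≤ (‖A‖ * ‖D‖ + ‖G‖) * ‖u‖ := by linarith
  calc ‖(empRegress H ξ z - A) u‖ = 2 / c₁ * (c₁ / 2 * ‖(empRegress H ξ z - A) u‖) := by
        field_simp
    _ ≤ 2 / c₁ * ((‖A‖ * ‖D‖ + ‖G‖) * ‖u‖) := by gcongr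
    _ = _ := by ring

/-- Empirical regression operators are consistent if the empirical covariances are. -/
theorem RootNClose.empRegress {Ω : ℕ → Type*} [∀ N, MeasurableSpace (Ω N)]
    {P : ∀ N, Measure (Ω N)} {μ : Measure 𝒳} {c₁ : ℝ} (hc₁ : 0 < c₁)
    (hcoer : ∀ ψ : H, c₁ * ‖ψ‖ ≤ ‖covX H μ ψ‖) {ξ : ∀ N, Ω N → Fin N → 𝒳}
    {z : ∀ N, Ω N → Fin N → K} {A : K →L[ℝ] H}
    (hξ : RootNClose P (fun N s => empCov H (ξ N s) fun j => feat H (ξ N s j)) (covX H μ))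
    (hz : RootNClose P (fun N s => empCov H (ξ N s) (z N s)) (covX H μ ∘L A)) :
    RootNClose P (fun N s => KKF.empRegress H (ξ N s) (z N s)) A := by
  refine (hξ.prodMk hz).of_calm (half_pos hc₁) (C := 2 / c₁ * (‖A‖ + 1)) (by positivity)
    (.of_forall fun N s hs => ?_)
  rw [Prod.mk_sub_mk, Prod.norm_mk] at hs ⊢
  refine (norm_empRegress_sub_le hc₁ hcoer (ξ N s) (z N s) A ((le_max_left _ _).trans hs)).trans ?_
  rw [mul_assoc, add_one_mul]
  gcongr
  · exact le_max_left _ _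
  · exact le_max_right _ _

end Regression

/-! ### The Koopman operators and the sampled data -/

section System

variable {n p : ℕ} {Ωw Ωv : Type*} [MeasurableSpace Ωw] [MeasurableSpace Ωv]
  (S : ObservedSystem n p Ωw Ωv) {𝒳 : Set (Euc n)} {𝒴 : Set (Euc p)}
  {H : Type*} [NormedAddCommGroup H] [InnerProductSpace ℝ H] [CompleteSpace H] [RKHS ℝ H 𝒳 ℝ]
  {μ μ₀ : Measure 𝒳} [IsProbabilityMeasure μ] [IsProbabilityMeasure μ₀]

namespace ObservedSystem

instance (N : ℕ) : IsProbabilityMeasure (S.sampleLaw μ μ₀ N) := by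
  unfold sampleLaw; infer_instance

theorem measurePreserving_pt (N : ℕ) : MeasurePreserving (fun s => s.unpack.pt)
    (S.sampleLaw μ μ₀ N) (Measure.pi fun _ : Fin N => μ) :=
  measurePreserving_fst

theorem measurePreserving_pt_w (N : ℕ) : MeasurePreserving (fun s => (s.unpack.pt, s.unpack.w))
    (S.sampleLaw μ μ₀ N)
    ((Measure.pi fun _ : Fin N => μ).prod (Measure.pi fun _ : Fin N => S.lawW)) :=
  (MeasurePreserving.id _).prod measurePreserving_fst

theorem measurePreserving_pt_v (N : ℕ) : MeasurePreserving (fun s => (s.unpack.pt, s.unpack.v))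
    (S.sampleLaw μ μ₀ N)
    ((Measure.pi fun _ : Fin N => μ).prod (Measure.pi fun _ : Fin N => S.lawV)) :=
  (MeasurePreserving.id _).prod (measurePreserving_fst.comp measurePreserving_snd)

theorem measurePreserving_init (N : ℕ) : MeasurePreserving (fun s => s.unpack.init)
    (S.sampleLaw μ μ₀ N) (Measure.pi fun _ : Fin N => μ₀) :=
  measurePreserving_fst.comp <| measurePreserving_snd.comp <|
    measurePreserving_snd.comp measurePreserving_snd

theorem measurePreserving_wk (k N : ℕ) : MeasurePreserving (fun s => s.unpack.wk k)
    (S.sampleLaw μ μ₀ N) (Measure.pi fun _ : Fin N => S.lawW) :=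
  (measurePreserving_eval_infinitePi _ k).comp <| measurePreserving_fst.comp <|
    measurePreserving_snd.comp <| measurePreserving_snd.comp <|
    measurePreserving_snd.comp measurePreserving_snd

theorem measurePreserving_vk (k N : ℕ) : MeasurePreserving (fun s => s.unpack.vk k)
    (S.sampleLaw μ μ₀ N) (Measure.pi fun _ : Fin N => S.lawV) :=
  (measurePreserving_eval_infinitePi _ k).comp <| measurePreserving_snd.comp <|
    measurePreserving_snd.comp <| measurePreserving_snd.comp <|
    measurePreserving_snd.comp measurePreserving_snd

theorem ae_g_mem (h𝒴 : IsCompact 𝒴) (hinv : S.IsInvariantPair 𝒳 𝒴) (x : 𝒳) :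
    ∀ᵐ v ∂S.lawV, S.g x v ∈ 𝒴 := by
  have hg : Measurable (S.g x) := S.measurable_g.comp measurable_prodMk_left
  have h := (hinv x x.2).2
  rw [rhoG, Measure.map_apply hg h𝒴.measurableSet] at h
  exact (mem_ae_iff_prob_eq_one (hg h𝒴.measurableSet)).2 h

theorem stronglyMeasurable_featExt_f (h𝒳 : IsCompact 𝒳) (hc : Continuous (feat H : 𝒳 → H)) :
    StronglyMeasurable fun q : 𝒳 × Ωw => featExt H (S.f q.1 q.2) :=
  (stronglyMeasurable_featExt h𝒳 hc).comp_measurable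
    (S.measurable_f.comp ((measurable_subtype_coe.comp measurable_fst).prodMk measurable_snd))

theorem measurable_g_coe : Measurable fun q : 𝒳 × Ωv => S.g q.1 q.2 :=
  S.measurable_g.comp ((measurable_subtype_coe.comp measurable_fst).prodMk measurable_snd)

theorem aestronglyMeasurable_g (x : 𝒳) : AEStronglyMeasurable (S.g x) S.lawV :=
  (S.measurable_g.comp measurable_prodMk_left).aestronglyMeasurable

theorem integral_nu {x : 𝒳} (hint : Integrable (S.g x) S.lawV) :
    ∫ v, S.nu x v ∂S.lawV = 0 := by
  simp only [nu]
  rw [integral_sub hint (integrable_const _)]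
  simp

/-- The functional `ψ ↦ (𝓤 ψ)(x)` is represented by the mean embedding `E[Φ(f(x, ·))]`, whose norm
is at most `M` uniformly in `x`; thus `toRKHS_apply` applies. -/
theorem koopman_apply (h𝒳 : IsCompact 𝒳) (hc : Continuous (feat H : 𝒳 → H)) {M : ℝ} (hM₀ : 0 ≤ M)
    (hM : ∀ x : 𝒳, ‖feat H x‖ ≤ M) {c₁ : ℝ} (hc₁ : 0 < c₁)
    (hcoer : ∀ ψ : H, c₁ * ‖ψ‖ ≤ ‖covX H μ ψ‖) (hU : S.KoopmanInvariant H) (ψ : H) (x : 𝒳) :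
    S.koopman H ψ x = ∫ w, inner ℝ ψ (featExt H (S.f x w)) ∂S.lawW := by
  have hint (x : 𝒳) : Integrable (fun w => featExt (𝒳 := 𝒳) H (S.f x w)) S.lawW :=
    .of_bound ((S.stronglyMeasurable_featExt_f h𝒳 hc).comp_measurable
      measurable_prodMk_left).aestronglyMeasurable M (.of_forall fun w => norm_featExt_le hM₀ hM _)
  have heq (ψ : H) (x : 𝒳) : S.koopmanFun (ψ : 𝒳 → ℝ) x =
      inner ℝ (∫ w, featExt H (S.f x w) ∂S.lawW) ψ := by
    rw [real_inner_comm, ← integral_inner (hint x), koopmanFun]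
    simp_rw [← inner_featExt, real_inner_comm]
  rw [koopman, toRKHS_apply hc hM hc₁ hcoer (B := M) (fun x => ?_) heq hU, heq, real_inner_comm,
    integral_inner (hint x)]
  exact (norm_integral_le_of_norm_le_const (.of_forall fun w => norm_featExt_le hM₀ hM _)).trans
    (by simp)

theorem obs_apply (hc : Continuous (feat H : 𝒳 → H)) {M : ℝ}
    (hM : ∀ x : 𝒳, ‖feat H x‖ ≤ M) {c₁ : ℝ} (hc₁ : 0 < c₁)
    (hcoer : ∀ ψ : H, c₁ * ‖ψ‖ ≤ ‖covX H μ ψ‖) (hG : S.ObsInvariant H) {B : ℝ}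
    (hB : ∀ x : 𝒳, ∀ᵐ v ∂S.lawV, ‖S.g x v‖ ≤ B) (q : Euc p) (x : 𝒳) :
    S.obs H q x = ∫ v, inner ℝ q (S.g x v) ∂S.lawV := by
  have hint (x : 𝒳) : Integrable (S.g x) S.lawV := .of_bound (S.aestronglyMeasurable_g x) B (hB x)
  have heq (q : Euc p) (x : 𝒳) : S.obsFun q x = inner ℝ (∫ v, S.g x v ∂S.lawV) q := by
    rw [real_inner_comm, ← integral_inner (hint x), obsFun]
  rw [obs, toRKHS_apply hc hM hc₁ hcoer (B := B) (fun x => ?_) heq hG, obsFun]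
  exact (norm_integral_le_of_norm_le_const (hB x)).trans (by simp)

end ObservedSystem

omit [IsProbabilityMeasure μ] in
theorem covX_comp_liftBack (hinv : (covX H μ).IsInvertible) :
    covX H μ ∘L liftBack H μ = covXId H μ := by
  obtain ⟨e, he⟩ := hinv
  rw [liftBack, ← he]
  ext u
  simp

theorem integrable_rankOne_of_bound {Ω K L : Type*} [MeasurableSpace Ω] {P : Measure Ω}
    [IsFiniteMeasure P] [NormedAddCommGroup K] [InnerProductSpace ℝ K] [NormedAddCommGroup L]
    [InnerProductSpace ℝ L] {Y : Ω → L} {Z : Ω → K} (hY : AEStronglyMeasurable Y P)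
    (hZ : AEStronglyMeasurable Z P) {M B : ℝ} (hM : ∀ᵐ ω ∂P, ‖Y ω‖ ≤ M)
    (hB : ∀ᵐ ω ∂P, ‖Z ω‖ ≤ B) : Integrable (fun ω => rankOne ℝ (Y ω) (Z ω)) P := by
  refine .of_bound (aestronglyMeasurable_rankOne hY hZ) (M * B) ?_
  filter_upwards [hM, hB] with ω h1 h2
  rw [norm_rankOne]
  exact mul_le_mul h1 h2 (norm_nonneg _) ((norm_nonneg _).trans h1)

/-! ### Consistency of empirical covariances -/

section EmpCov

variable [FiniteDimensional ℝ H] {K : Type*} [NormedAddCommGroup K] [InnerProductSpace ℝ K]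
  [FiniteDimensional ℝ K]

omit [CompleteSpace H] [RKHS ℝ H 𝒳 ℝ] in
theorem rootNClose_mean_rankOne {Ω : Type*} [MeasurableSpace Ω] {P : Measure Ω}
    [IsProbabilityMeasure P] {Y : Ω → H} {Z : Ω → K} (hY : AEStronglyMeasurable Y P)
    (hZ : AEStronglyMeasurable Z P) {M B : ℝ} (hM : ∀ᵐ ω ∂P, ‖Y ω‖ ≤ M)
    (hB : ∀ᵐ ω ∂P, ‖Z ω‖ ≤ B) :
    RootNClose (fun N => Measure.pi fun _ : Fin N => P)
      (fun N ω => (1 / (N : ℝ)) • ∑ j, rankOne ℝ (Y (ω j)) (Z (ω j)))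
      (∫ ω, rankOne ℝ (Y ω) (Z ω) ∂P) := by
  have hbd : ∀ᵐ ω ∂P, ‖rankOne ℝ (Y ω) (Z ω)‖ ≤ M * B := by
    filter_upwards [hM, hB] with ω h1 h2
    rw [norm_rankOne]
    exact mul_le_mul h1 h2 (norm_nonneg _) ((norm_nonneg _).trans h1)
  have h := rootNClose_mean (aestronglyMeasurable_rankOne hY hZ) hbd
  exact h

/-- Empirical covariances with the sample points are consistent. -/
theorem rootNClose_empCov_pt (hc : Continuous (feat H : 𝒳 → H)) {M : ℝ}
    (hM : ∀ x : 𝒳, ‖feat H x‖ ≤ M) {Z : 𝒳 → K} (hZ : AEStronglyMeasurable Z μ) {B : ℝ}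
    (hB : ∀ᵐ x ∂μ, ‖Z x‖ ≤ B) :
    RootNClose (fun N => Measure.pi fun _ : Fin N => μ)
      (fun _ s => empCov H s fun j => Z (s j)) (∫ x, rankOne ℝ (feat H x) (Z x) ∂μ) :=
  rootNClose_mean_rankOne hc.aestronglyMeasurable hZ (.of_forall hM) hB

/-- Empirical covariances with observables that depend on sample points and noises are
consistent. -/
theorem rootNClose_empCov_prod (hc : Continuous (feat H : 𝒳 → H)) {M : ℝ}
    (hM : ∀ x : 𝒳, ‖feat H x‖ ≤ M) {Ω : Type*} [MeasurableSpace Ω] {P : Measure Ω}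
    [IsProbabilityMeasure P] {Z : 𝒳 × Ω → K} (hZ : AEStronglyMeasurable Z (μ.prod P)) {B : ℝ}
    (hB : ∀ᵐ q ∂μ.prod P, ‖Z q‖ ≤ B) :
    RootNClose (fun N => (Measure.pi fun _ : Fin N => μ).prod (Measure.pi fun _ : Fin N => P))
      (fun _ s => empCov H s.1 fun j => Z (s.1 j, s.2 j))
      (∫ q, rankOne ℝ (feat H q.1) (Z q) ∂μ.prod P) := by
  have hY : AEStronglyMeasurable (fun q : 𝒳 × Ω => feat H q.1) (μ.prod P) :=
    (hc.stronglyMeasurable.comp_measurable measurable_fst).aestronglyMeasurable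
  have h := rootNClose_mean_rankOne hY hZ (.of_forall fun q => hM q.1) hB
  -- A tuple of `N` independent pairs (point, noise) has the same law as a tuple of points paired
  -- with an independent tuple of noises.
  have hmp (N : ℕ) := (measurePreserving_arrowProdEquivProdArrow 𝒳 Ω (Fin N)
    (fun _ => μ) (fun _ => P)).symm
  have h' := h.comp_measurePreserving hmp
  exact h'

end EmpCov

end System

/-! ### Consistency of the Koopman Kalman filter -/

section Consistency

variable {n p : ℕ} {Ωw Ωv : Type*} [MeasurableSpace Ωw] [MeasurableSpace Ωv]
  (S : ObservedSystem n p Ωw Ωv) {𝒳 : Set (Euc n)} {𝒴 : Set (Euc p)}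
  {H : Type*} [NormedAddCommGroup H] [InnerProductSpace ℝ H] [CompleteSpace H] [RKHS ℝ H 𝒳 ℝ]
  {μ μ₀ : Measure 𝒳} [IsProbabilityMeasure μ] [IsProbabilityMeasure μ₀]

namespace ObservedSystem

/-! ### Consistency of the regression operators -/

section Operators

variable [FiniteDimensional ℝ H] {c₁ M : ℝ}

theorem rootNClose_covX (hc : Continuous (feat H : 𝒳 → H)) (hM : ∀ x : 𝒳, ‖feat H x‖ ≤ M) :
    RootNClose (S.sampleLaw μ μ₀)
      (fun _ s => empCov H s.unpack.pt fun j => feat H (s.unpack.pt j)) (covX H μ) := by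
  have h := rootNClose_empCov_pt (μ := μ) hc hM hc.aestronglyMeasurable (.of_forall hM)
  exact h.comp_measurePreserving S.measurePreserving_pt

theorem rootNClose_liftBackN (h𝒳 : IsCompact 𝒳) (hc : Continuous (feat H : 𝒳 → H))
    (hM : ∀ x : 𝒳, ‖feat H x‖ ≤ M) (hc₁ : 0 < c₁)
    (hcoer : ∀ ψ : H, c₁ * ‖ψ‖ ≤ ‖covX H μ ψ‖) :
    RootNClose (S.sampleLaw μ μ₀) (fun _ s => liftBackN H s.unpack) (liftBack H μ) := by
  obtain ⟨B, hB⟩ := h𝒳.isBounded.exists_norm_le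
  refine (S.rootNClose_covX hc hM).empRegress hc₁ hcoer ?_
  rw [covX_comp_liftBack (isInvertible_covX hc₁ hcoer)]
  have h := rootNClose_empCov_pt (μ := μ) (Z := fun x : 𝒳 => (x : Euc n)) hc hM
    continuous_subtype_val.aestronglyMeasurable (.of_forall fun x => hB x x.2)
  exact h.comp_measurePreserving S.measurePreserving_pt

theorem rootNClose_koopmanN (h𝒳 : IsCompact 𝒳) (hc : Continuous (feat H : 𝒳 → H)) (hM₀ : 0 ≤ M)
    (hM : ∀ x : 𝒳, ‖feat H x‖ ≤ M) (hc₁ : 0 < c₁)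
    (hcoer : ∀ ψ : H, c₁ * ‖ψ‖ ≤ ‖covX H μ ψ‖) (hU : S.KoopmanInvariant H) :
    RootNClose (S.sampleLaw μ μ₀) (fun _ s => S.koopmanN H s.unpack) (S.koopman H) := by
  have hZ : AEStronglyMeasurable (fun q : 𝒳 × Ωw => featExt H (S.f q.1 q.2)) (μ.prod S.lawW) :=
    (S.stronglyMeasurable_featExt_f h𝒳 hc).aestronglyMeasurable
  have hB : ∀ᵐ q ∂μ.prod S.lawW, ‖featExt (𝒳 := 𝒳) H (S.f q.1 q.2)‖ ≤ M :=
    .of_forall fun q => norm_featExt_le hM₀ hM _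
  have hY : AEStronglyMeasurable (fun q : 𝒳 × Ωw => feat H q.1) (μ.prod S.lawW) :=
    (hc.stronglyMeasurable.comp_measurable measurable_fst).aestronglyMeasurable
  refine (S.rootNClose_covX hc hM).empRegress hc₁ hcoer ?_
  have hYM : ∀ᵐ q : 𝒳 × Ωw ∂μ.prod S.lawW, ‖feat H q.1‖ ≤ M := .of_forall fun q => hM q.1
  have hint := integrable_rankOne_of_bound hY hZ hYM hB
  have hnormal := covX_comp_eq hc hM hint (S.koopman_apply h𝒳 hc hM₀ hM hc₁ hcoer hU)
  rw [hnormal]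
  have h := rootNClose_empCov_prod hc hM hZ hB
  have h' := h.comp_measurePreserving (S.measurePreserving_pt_w (μ₀ := μ₀))
  exact h'

theorem rootNClose_obsN (hc : Continuous (feat H : 𝒳 → H))
    (hM : ∀ x : 𝒳, ‖feat H x‖ ≤ M) (hc₁ : 0 < c₁)
    (hcoer : ∀ ψ : H, c₁ * ‖ψ‖ ≤ ‖covX H μ ψ‖) (hG : S.ObsInvariant H) {B : ℝ}
    (hB : ∀ x : 𝒳, ∀ᵐ v ∂S.lawV, ‖S.g x v‖ ≤ B) :
    RootNClose (S.sampleLaw μ μ₀) (fun _ s => S.obsN H s.unpack) (S.obs H) := by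
  have hmeas := S.measurable_g_coe (𝒳 := 𝒳)
  have hZ : AEStronglyMeasurable (fun q : 𝒳 × Ωv => S.g q.1 q.2) (μ.prod S.lawV) :=
    hmeas.aestronglyMeasurable
  have hB' : ∀ᵐ q ∂μ.prod S.lawV, ‖S.g q.1 q.2‖ ≤ B :=
    (Measure.ae_prod_iff_ae_ae (hmeas.norm measurableSet_Iic)).2 (.of_forall hB)
  have hY : AEStronglyMeasurable (fun q : 𝒳 × Ωv => feat H q.1) (μ.prod S.lawV) :=
    (hc.stronglyMeasurable.comp_measurable measurable_fst).aestronglyMeasurable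
  refine (S.rootNClose_covX hc hM).empRegress hc₁ hcoer ?_
  have hYM : ∀ᵐ q : 𝒳 × Ωv ∂μ.prod S.lawV, ‖feat H q.1‖ ≤ M := .of_forall fun q => hM q.1
  have hint := integrable_rankOne_of_bound hY hZ hYM hB'
  have hnormal := covX_comp_eq hc hM hint (S.obs_apply hc hM hc₁ hcoer hG hB)
  rw [hnormal]
  have h := rootNClose_empCov_prod hc hM hZ hB'
  have h' := h.comp_measurePreserving (S.measurePreserving_pt_v (μ₀ := μ₀))
  exact h'

end Operators

/-! ### Bounds and nondegeneracy of the noises -/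

section Noise

variable {M B : ℝ}

theorem aestronglyMeasurable_zeta (h𝒳 : IsCompact 𝒳) (hc : Continuous (feat H : 𝒳 → H)) (x : 𝒳) :
    AEStronglyMeasurable (S.zeta H x) S.lawW :=
  (((S.stronglyMeasurable_featExt_f h𝒳 hc).comp_measurable
    (measurable_prodMk_left (x := x))).sub stronglyMeasurable_const).aestronglyMeasurable

theorem norm_zeta_le (hM₀ : 0 ≤ M) (hM : ∀ x : 𝒳, ‖feat H x‖ ≤ M) (x : 𝒳) (w : Ωw) :
    ‖S.zeta H x w‖ ≤ M + M :=
  (norm_sub_le _ _).trans (add_le_add (norm_featExt_le hM₀ hM _)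
    ((norm_integral_le_of_norm_le_const (.of_forall fun w => norm_featExt_le hM₀ hM _)).trans
      (by simp)))

theorem aestronglyMeasurable_nu (x : 𝒳) : AEStronglyMeasurable (S.nu x) S.lawV :=
  (S.aestronglyMeasurable_g x).sub aestronglyMeasurable_const

theorem norm_nu_le (hB : ∀ x : 𝒳, ∀ᵐ v ∂S.lawV, ‖S.g x v‖ ≤ B) (x : 𝒳) :
    ∀ᵐ v ∂S.lawV, ‖S.nu x v‖ ≤ B + B := by
  filter_upwards [hB x] with v hv
  exact (norm_sub_le _ _).trans (add_le_add hv
    ((norm_integral_le_of_norm_le_const (hB x)).trans (by simp)))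

/-- The covariance of a nondegenerate observation noise is positive definite. -/
theorem covOp_nu_definite (hB : ∀ x : 𝒳, ∀ᵐ v ∂S.lawV, ‖S.g x v‖ ≤ B)
    (hg : S.NondegenerateObs 𝒳) (x : 𝒳) (u : Euc p)
    (hu : inner ℝ (covOp S.lawV (S.nu x) u) u ≤ 0) : u = 0 := by
  have h0 : ∫ v, S.nu x v ∂S.lawV = 0 :=
    S.integral_nu (.of_bound (S.aestronglyMeasurable_g x) B (hB x))
  rw [inner_covOp (S.aestronglyMeasurable_nu x) (S.norm_nu_le hB x), h0] at hu
  simp only [sub_zero, ← pow_two] at hu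
  exact hg x x.2 u (le_antisymm hu (integral_nonneg fun v => sq_nonneg _))

end Noise

/-- The estimates of the Koopman Kalman filter are `√N`-consistent for those of the
infinite-dimensional filter. Invariance of `H` under the lifting-back operator is automatic, as the
autocovariance operator is invertible. -/
theorem rootNClose_estimates (h𝒳 : IsCompact 𝒳) (h𝒴 : IsCompact 𝒴)
    (hinv : S.IsInvariantPair 𝒳 𝒴) (hg : S.NondegenerateObs 𝒳)
    (hk : Continuous fun q : 𝒳 × 𝒳 => ker H q.1 q.2) {c₁ : ℝ} (hc₁ : 0 < c₁)
    (hcoer : ∀ ψ : H, c₁ * ‖ψ‖ ≤ ‖covX H μ ψ‖) (hU : S.KoopmanInvariant H)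
    (hG : S.ObsInvariant H) (x : ℕ → 𝒳) (y : ℕ → Euc p) (k : ℕ) :
    RootNClose (S.sampleLaw μ μ₀)
      (fun _ s => (S.stateEstN H x y s.unpack k, S.stateCovN H x y s.unpack k))
      (S.stateEst H μ μ₀ x y k, S.stateCov H μ μ₀ x y k) := by
  have hc := continuous_feat hk
  obtain ⟨M, hM₀, hM⟩ := exists_norm_feat_le h𝒳 hc
  have hfin := finiteDimensional_of_covX hc hM hc₁ hcoer
  obtain ⟨B, hB𝒴⟩ := h𝒴.isBounded.exists_norm_le
  have hB (x : 𝒳) : ∀ᵐ v ∂S.lawV, ‖S.g x v‖ ≤ B :=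
    (S.ae_g_mem h𝒴 hinv x).mono fun v hv => hB𝒴 _ hv
  have hz (k : ℕ) := S.aestronglyMeasurable_zeta h𝒳 hc (x (k - 1))
  have hzM (k : ℕ) : ∀ᵐ w ∂S.lawW, ‖S.zeta H (x (k - 1)) w‖ ≤ M + M :=
    .of_forall (S.norm_zeta_le hM₀ hM (x (k - 1)))
  have hn (k : ℕ) := S.aestronglyMeasurable_nu (x k)
  have hnB (k : ℕ) := S.norm_nu_le hB (x k)
  have hfM : ∀ᵐ z ∂μ₀, ‖feat H z‖ ≤ M := .of_forall hM
  have hA := (S.rootNClose_koopmanN (μ₀ := μ₀) h𝒳 hc hM₀ hM hc₁ hcoer hU).map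
    (differentiable_adjoint _)
  have hC := (S.rootNClose_obsN (μ₀ := μ₀) hc hM hc₁ hcoer hG hB).map (differentiable_adjoint _)
  have hQ (k : ℕ) := (rootNClose_sampleCov (hz k) (hzM k)).comp_measurePreserving
    (S.measurePreserving_wk (μ := μ) (μ₀ := μ₀) k)
  have hR (k : ℕ) := (rootNClose_sampleCov (hn k) (hnB k)).comp_measurePreserving
    (S.measurePreserving_vk (μ := μ) (μ₀ := μ₀) k)
  have hσ := ((rootNClose_sampleMean hc.aestronglyMeasurable hfM).prodMk
    (rootNClose_sampleCov hc.aestronglyMeasurable hfM)).comp_measurePreserving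
    (S.measurePreserving_init (μ := μ))
  have hfilter : RootNClose (S.sampleLaw μ μ₀) (fun _ s => S.filterN H x y s.unpack k)
      (S.filter H μ₀ x y k) := by
    have h := RootNClose.kalman y hA hC hQ hR hσ (fun k => isPositive_covOp (hz k) (hzM k))
      (fun k => isPositive_covOp (hn k) (hnB k)) (fun k => S.covOp_nu_definite hB hg (x k))
      (isPositive_covOp hc.aestronglyMeasurable hfM) k
    exact h
  have hlift := S.rootNClose_liftBackN (μ₀ := μ₀) h𝒳 hc hM hc₁ hcoer
  -- Both estimates are one differentiable function of the lifting-back operator and the filter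
  -- state.
  let φ : (Euc n →L[ℝ] H) × H × (H →L[ℝ] H) → Euc n × (Euc n →L[ℝ] Euc n) :=
    fun t => (t.1.adjoint t.2.1, t.1.adjoint ∘L t.2.2 ∘L t.1)
  have hφ : Differentiable ℝ φ := fun t => by unfold φ; fun_prop
  have h := (hlift.prodMk hfilter).map (hφ _)
  exact h

end ObservedSystem

end Consistency

end KKF

end

/-! ### From consistency to a bound for every sample size -/

open KKF in
theorem mainTheorem1 {n p : ℕ} {Ωw Ωv : Type*} [MeasurableSpace Ωw] [MeasurableSpace Ωv]
    (S : ObservedSystem n p Ωw Ωv)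
    (𝒳 : Set (Euc n)) (𝒴 : Set (Euc p)) (h𝒳 : IsCompact 𝒳) (h𝒴 : IsCompact 𝒴)
    (hinv : S.IsInvariantPair 𝒳 𝒴) (hg : S.NondegenerateObs 𝒳)
    (H : Type*) [NormedAddCommGroup H] [InnerProductSpace ℝ H] [CompleteSpace H] [RKHS ℝ H 𝒳 ℝ]
    (hk : Continuous fun q : 𝒳 × 𝒳 => ker H q.1 q.2)
    (μ μ₀ : Measure 𝒳) [IsProbabilityMeasure μ] [IsProbabilityMeasure μ₀]
    (c₁ : ℝ) (hc₁ : 0 < c₁) (hcoer : ∀ ψ : H, c₁ * ‖ψ‖ ≤ ‖covX H μ ψ‖)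
    (hU : S.KoopmanInvariant H) (hG : S.ObsInvariant H) (hB : LiftBackInvariant H μ)
    (T : ℕ) (x : ℕ → 𝒳) (y : ℕ → Euc p) (δ : ℝ) (hδ : δ ∈ Set.Ioo (0 : ℝ) 1) :
    ∃ C₁ C₂ : ℕ → ℝ, ∀ N : ℕ, 2 ≤ N →
      2 * Real.exp (-(N * c₁ ^ 2) / (8 * max (S.gSup 𝒳) (kerSup H))) < δ →
      ENNReal.ofReal ((1 - δ) ^ (4 + 2 * (T + 1))) ≤
        S.sampleLaw μ μ₀ N {s | ∀ k ≤ T,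
          ‖S.stateEst H μ μ₀ x y k - S.stateEstN H x y s.unpack k‖
              ≤ C₁ k * (N : ℝ) ^ (-(1 / 2) : ℝ) ∧
          ‖S.stateCov H μ μ₀ x y k - S.stateCovN H x y s.unpack k‖
              ≤ C₂ k * (N : ℝ) ^ (-(1 / 2) : ℝ)} := by
  have hq : ENNReal.ofReal ((1 - δ) ^ (4 + 2 * (T + 1))) < 1 := by
    rw [ENNReal.ofReal_lt_one]
    exact pow_lt_one₀ (by linarith [hδ.2]) (by linarith [hδ.1]) (by omega)
  -- Stacking the `T + 1` times puts all errors into a single sup norm, so one event and one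
  -- constant `C` serve every `k` and both estimates.
  obtain ⟨C, hC⟩ := (RootNClose.pi fun k : Fin (T + 1) =>
    S.rootNClose_estimates (μ := μ) (μ₀ := μ₀) h𝒳 h𝒴 hinv hg hk hc₁ hcoer hU hG x y k)
    |>.exists_forall_le_measure hq
  refine ⟨fun _ => C, fun _ => C, fun N hN _ => (hC N (by omega)).trans (measure_mono ?_)⟩
  intro s hs k hkT
  have h := (norm_le_pi_norm _ (⟨k, Nat.lt_succ_of_le hkT⟩ : Fin (T + 1))).trans hs
  rw [norm_sub_rev, norm_sub_rev (S.stateCov H μ μ₀ x y k)]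
  exact ⟨(norm_fst_le _).trans h, (norm_snd_le _).trans h⟩
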